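/- Let $G=(V,E)$ be a finite simple connected graph with $n$ vertices. A greyscale of $G$ is a map $f:V\to[0,1]$ that takes both values $0$ and $1$; its gradation vector $\mathcal G_f$ lists the numbers $|f(u)-f(v)|$, $uv\in E$, with multiplicity, in decreasing order. Gradation vectors are compared lexicographically. Let $V_c\subseteq V$ and let $g:V_c\to[0,1]$ be a map (an incomplete greyscale) that takes both values $0$ and $1$. A greyscale $f$ is compatible with $g$ if $f=g$ on $V_c$. Procedure ($V_c$-Compatible-Complete-Mapping). Put $G_1=G$ and $f=g$ on $V_c$. While $V_c\ne V$, do the following for $i=1,2,\dots$, with distances and geodesics taken in $G_i$. If some component of $G_i$ contains two distinct elements of $V_c$, let $M_i$ be the maximum of $F(u,v)=|f(u)-f(v)|/d(u,v)$ over all pairs of distinct elements $u,v$ of $V_c$ lying in a common component, and let $S_i$ be the set of the pairs attaining it; treat the pairs $\{u,v\}\in S_i$, named so that $f(u)\le f(v)$, one after the other in any order: put $f(w)=f(u)+d(u,w)M_i$ for every vertex $w$ of the set $A_{uv}$ of vertices lying on $u$–$v$ geodesics, and add $A_{uv}$ to $V_c$; finally let $G_{i+1}$ arise from $G_i$ by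 deleting all edges with both ends in a common set $A_{uv}$, $\{u,v\}\in S_i$. If each component of $G_i$ contains exactly one element of $V_c$, give every vertex the colour of the element of $V_c$ in its component, put $V_c=V$ and $G_{i+1}=G_i$. Theorem. 1. There is exactly one greyscale $f$ compatible with $g$ whose gradation vector is lexicographically minimum among all greyscales compatible with $g$. 2. Every execution of the procedure halts after at most $|E|$ passes through the loop, and its output is $f$. 3. The output $f$ of the procedure can be computed in $O(n^4)$ steps: there are a program for a random access machine with exact real arithmetic at unit cost and a constant $C$ such that, for all $G$, $V_c$ and $g$ as above, the program halts on the input $(G,V_c,g)$ after at most $Cn^4$ steps with output $f$. 4. If the loop is carried on for as long as $G_i$ has an edge (instead of $V_c\neq V$), every execution halts after at most $|E|+1$ passes, again with output $f$; the successive maxima that it finds are $M_1>M_2>\dots>M_r>0$, possibly followed by zeros, and $$\mathcal G_f=(M_1,\dots,M_1,M_2,\dots,M_2,\dots,M_r,\dots,M_r,0,\dots,0),$$ where each $M_i$ occurs at least once and the number of zeros at the end may be $0$. -/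

import Mathlib

namespace Gradation

/-! ### Greyscales and gradation vectors -/

section Greyscales

variable {V : Type*}

/-- A greyscale: all values lie in `[0,1]`, and the extreme tones `0` and `1` are both reached. -/
def IsGreyscale (f : V → ℝ) : Prop :=
  (∀ v, f v ∈ Set.Icc (0 : ℝ) 1) ∧ (∃ v, f v = 0) ∧ (∃ v, f v = 1)

/-- An incomplete greyscale on `Vc`: a mapping from `Vc` to `[0,1]`. -/
def IsIncompleteGreyscale {Vc : Set V} (g : Vc → ℝ) : Prop :=
  ∀ u, g u ∈ Set.Icc (0 : ℝ) 1

/-- `f` is compatible with the mapping `g` given on `Vc`. -/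
def Compatible {Vc : Set V} (g : Vc → ℝ) (f : V → ℝ) : Prop :=
  ∀ u : Vc, f u = g u

/-- The grey tone `|f u - f v|` of the edge `uv`. -/
def edgeTone (f : V → ℝ) : Sym2 V → ℝ :=
  Sym2.lift ⟨fun u v => |f u - f v|, fun u v => abs_sub_comm (f u) (f v)⟩

open Classical in
/-- The gradation vector: the grey tones of all edges of `G`, with multiplicity, in decreasing
order. -/
noncomputable def gradation [Fintype V] (G : SimpleGraph V) (f : V → ℝ) : List ℝ :=
  (G.edgeFinset.val.map (edgeTone f)).sort (· ≥ ·)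

/-- `f` is a greyscale compatible with `g` whose gradation vector is lexicographically minimum among
those of all greyscales compatible with `g` (`≤` on lists is the lexicographic order). -/
def IsMinGradation [Fintype V] (G : SimpleGraph V) {Vc : Set V} (g : Vc → ℝ) (f : V → ℝ) : Prop :=
  IsGreyscale f ∧ Compatible g f ∧
    ∀ h : V → ℝ, IsGreyscale h → Compatible g h → gradation G f ≤ gradation G h

end Greyscales

/-! ### The `V_c`-Compatible-Complete-Mapping procedure -/

section Procedure

variable {V : Type*}

/-- The set of the vertices that lie on some `u`-`v` geodesic of `H`. -/
def geodesicVertices (H : SimpleGraph V) (u v : V) : Set V :=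
  {w | ∃ p : H.Walk u v, p.length = H.dist u v ∧ w ∈ p.support}

/-- The edge-colour-increase mapping `F(u,v) = |f u - f v| / d(u,v)`, and `F(u,u) = 0`. It is only
used for vertices in the same connected component of `H`. -/
noncomputable def colourIncrease (H : SimpleGraph V) (f : V → ℝ) (u v : V) : ℝ :=
  |f u - f v| / (H.dist u v : ℝ)

/-- The variables of the procedure: the current graph `G_i`, the current set `V_c` of coloured
vertices and the colours `f`, which are only meaningful on `V_c`. The graph is stored as a graph on
all of `V`: vertices that have become isolated are not discarded, but they are coloured and belong
to no pair that is considered below. -/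
structure State (V : Type*) where
  graph : SimpleGraph V
  coloured : Set V
  tone : V → ℝ

/-- The pairs of distinct coloured vertices in the same connected component of the current graph. -/
def State.pairs (σ : State V) : Set (V × V) :=
  {p | p.1 ≠ p.2 ∧ p.1 ∈ σ.coloured ∧ p.2 ∈ σ.coloured ∧ σ.graph.Reachable p.1 p.2}

/-- `M` is the maximum of `F` over these pairs (there is none if there is no such pair). -/
def State.IsMaxIncrease (σ : State V) (M : ℝ) : Prop :=
  IsGreatest ((fun p : V × V => colourIncrease σ.graph σ.tone p.1 p.2) '' σ.pairs) M

/-- `L` lists, in some order, every unordered pair `{u,v}` of `State.pairs` with `F(u,v) = M`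
exactly once; each of them may be written as `(u,v)` or as `(v,u)`. -/
def State.Lists (σ : State V) (M : ℝ) (L : List (V × V)) : Prop :=
  (L.map fun p => s(p.1, p.2)).Nodup ∧
    ∀ u v, ((u, v) ∈ L ∨ (v, u) ∈ L) ↔
      ((u, v) ∈ σ.pairs ∧ colourIncrease σ.graph σ.tone u v = M)

open Classical in
/-- The assignment of colours to all vertices of the `u`-`v` geodesics, where `p = (u,v)`. -/
noncomputable def colourGeodesics (H : SimpleGraph V) (M : ℝ) (f : V → ℝ) (p : V × V) : V → ℝ :=
  fun w =>
    if w ∈ geodesicVertices H p.1 p.2 then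
      if f p.1 ≤ f p.2 then f p.1 + H.dist w p.1 * M else f p.2 + H.dist w p.2 * M
    else f w

/-- One execution of the body of the loop. The label is `some M` if a maximum `M` was found, and
`none` if there was no pair of coloured vertices to consider. -/
inductive Step : State V → Option ℝ → State V → Prop
  /-- The maximum `M` exists. The pairs that attain it are treated one after the other, in any
  order; then every edge is deleted that joins two vertices of the geodesics of one such pair. -/
  | geodesics (σ : State V) (M : ℝ) (L : List (V × V))
      (hM : σ.IsMaxIncrease M) (hL : σ.Lists M L) :
      Step σ (some M)
        { graph := σ.graph.deleteEdges
            {e | ∃ p ∈ L, ∀ w ∈ e, w ∈ geodesicVertices σ.graph p.1 p.2}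
          coloured := σ.coloured ∪ {w | ∃ p ∈ L, w ∈ geodesicVertices σ.graph p.1 p.2}
          tone := L.foldl (colourGeodesics σ.graph M) σ.tone }
  /-- Every connected component contains exactly one coloured vertex (`c w` is the one in the
  component of `w`), so that no pair is left; each component gets the colour of that vertex. -/
  | components (σ : State V) (c : V → V)
      (hc : ∀ w x, (x ∈ σ.coloured ∧ σ.graph.Reachable w x) ↔ x = c w) :
      Step σ none
        { graph := σ.graph
          coloured := Set.univ
          tone := fun w => σ.tone (c w) }

/-- The states at the start of the procedure (the colours outside `V_c` are arbitrary). -/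
def IsInitial (G : SimpleGraph V) {Vc : Set V} (g : Vc → ℝ) (σ : State V) : Prop :=
  σ.graph = G ∧ σ.coloured = Vc ∧ Compatible g σ.tone

/-- `Exec guard G g l σ`: the procedure with input `g` on `G`, with loop `while guard do body`,
can reach the state `σ` after `l.length` executions of the body, whose labels are `l` in
chronological order. -/
inductive Exec (guard : State V → Prop) (G : SimpleGraph V) {Vc : Set V} (g : Vc → ℝ) :
    List (Option ℝ) → State V → Prop
  | start (σ : State V) (h : IsInitial G g σ) : Exec guard G g [] σ
  | step (l : List (Option ℝ)) (σ : State V) (o : Option ℝ) (σ' : State V)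
      (h : Exec guard G g l σ) (hg : guard σ) (hs : Step σ o σ') :
      Exec guard G g (l ++ [o]) σ'

/-- The guard of the procedure: some vertex is not coloured. -/
def VertexLeft (σ : State V) : Prop := σ.coloured ≠ Set.univ

/-- The guard of the prolonged procedure: some edge is not deleted. -/
def EdgeLeft (σ : State V) : Prop := σ.graph ≠ ⊥

end Procedure

/-! ### Unit-cost programs with real arithmetic -/

section Programs

/-- The memory of a random access machine with exact real arithmetic: registers and matrices (each
named by a number) of natural numbers and of real numbers. -/
structure Store where
  ireg : ℕ → ℕ
  rreg : ℕ → ℝ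
  imat : ℕ → ℕ → ℕ → ℕ
  rmat : ℕ → ℕ → ℕ → ℝ

/-- Elementary instructions. In the comments, `x, y, z` are registers for natural numbers, `r, s, t`
registers for real numbers, and `a` is a matrix. -/
inductive Instr
  /-- `x := c`, for a fixed number `c` -/
  | iconst (x c : ℕ)
  /-- `x := y + z` -/
  | iadd (x y z : ℕ)
  /-- `x := y - z`, truncated at `0` -/
  | isub (x y z : ℕ)
  /-- `x := a[y, z]` -/
  | iload (x a y z : ℕ)
  /-- `a[y, z] := x` -/
  | istore (a y z x : ℕ)
  /-- `r := x` -/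
  | rcast (r x : ℕ)
  /-- `r := s + t` -/
  | radd (r s t : ℕ)
  /-- `r := s - t` -/
  | rsub (r s t : ℕ)
  /-- `r := s * t` -/
  | rmul (r s t : ℕ)
  /-- `r := s / t` (a division by `0` gives `0`) -/
  | rdiv (r s t : ℕ)
  /-- `r := a[y, z]` -/
  | rload (r a y z : ℕ)
  /-- `a[y, z] := r` -/
  | rstore (a y z r : ℕ)

/-- Change one entry of one matrix. -/
def setEntry {α : Type} (m : ℕ → ℕ → ℕ → α) (a i j : ℕ) (x : α) : ℕ → ℕ → ℕ → α :=
  fun a' i' j' => if a' = a ∧ i' = i ∧ j' = j then x else m a' i' j'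

/-- The effect of an instruction. -/
noncomputable def Instr.exec (m : Store) : Instr → Store
  | iconst x c => { m with ireg := Function.update m.ireg x c }
  | iadd x y z => { m with ireg := Function.update m.ireg x (m.ireg y + m.ireg z) }
  | isub x y z => { m with ireg := Function.update m.ireg x (m.ireg y - m.ireg z) }
  | iload x a y z => { m with ireg := Function.update m.ireg x (m.imat a (m.ireg y) (m.ireg z)) }
  | istore a y z x => { m with imat := setEntry m.imat a (m.ireg y) (m.ireg z) (m.ireg x) }
  | rcast r x => { m with rreg := Function.update m.rreg r (m.ireg x : ℝ) }
  | radd r s t => { m with rreg := Function.update m.rreg r (m.rreg s + m.rreg t) }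
  | rsub r s t => { m with rreg := Function.update m.rreg r (m.rreg s - m.rreg t) }
  | rmul r s t => { m with rreg := Function.update m.rreg r (m.rreg s * m.rreg t) }
  | rdiv r s t => { m with rreg := Function.update m.rreg r (m.rreg s / m.rreg t) }
  | rload r a y z => { m with rreg := Function.update m.rreg r (m.rmat a (m.ireg y) (m.ireg z)) }
  | rstore a y z r => { m with rmat := setEntry m.rmat a (m.ireg y) (m.ireg z) (m.rreg r) }

/-- Tests: comparison of two registers. -/
inductive Test
  | ilt (x y : ℕ)
  | rlt (r s : ℕ)

/-- The truth of a test. -/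
def Test.Holds (m : Store) : Test → Prop
  | ilt x y => m.ireg x < m.ireg y
  | rlt r s => m.rreg r < m.rreg s

/-- Programs. -/
inductive Prog
  | skip
  | instr (i : Instr)
  | seq (p q : Prog)
  | ite (b : Test) (p q : Prog)
  | loop (b : Test) (p : Prog)

/-- `Runs p m t m'`: started with memory `m`, the program `p` halts after exactly `t` steps with
memory `m'`. Every instruction and every evaluation of a test is one step. -/
inductive Runs : Prog → Store → ℕ → Store → Prop
  | skip (m : Store) : Runs .skip m 1 m
  | instr (i : Instr) (m : Store) : Runs (.instr i) m 1 (i.exec m)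
  | seq (p q : Prog) (m m' m'' : Store) (t t' : ℕ)
      (hp : Runs p m t m') (hq : Runs q m' t' m'') : Runs (.seq p q) m (t + t') m''
  | ite_true (b : Test) (p q : Prog) (m m' : Store) (t : ℕ)
      (hb : b.Holds m) (hp : Runs p m t m') : Runs (.ite b p q) m (1 + t) m'
  | ite_false (b : Test) (p q : Prog) (m m' : Store) (t : ℕ)
      (hb : ¬ b.Holds m) (hq : Runs q m t m') : Runs (.ite b p q) m (1 + t) m'
  | loop_stop (b : Test) (p : Prog) (m : Store)
      (hb : ¬ b.Holds m) : Runs (.loop b p) m 1 m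
  | loop_continue (b : Test) (p : Prog) (m m' m'' : Store) (t t' : ℕ)
      (hb : b.Holds m) (hp : Runs p m t m') (hl : Runs (.loop b p) m' t' m'') :
      Runs (.loop b p) m (1 + t + t') m''

open Classical in
/-- The memory `m` holds the input: the vertices are numbered by `e`, register `0` holds the number
of vertices, integer matrix `0` is the adjacency matrix, row `0` of integer matrix `1` marks the
vertices of `Vc`, and row `0` of real matrix `0` holds the values of `g` at these vertices. All other
cells are arbitrary. -/
def IsInput {V : Type*} {n : ℕ} (e : V ≃ Fin n) (G : SimpleGraph V) {Vc : Set V} (g : Vc → ℝ)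
    (m : Store) : Prop :=
  m.ireg 0 = n ∧
  (∀ u v, m.imat 0 (e u) (e v) = if G.Adj u v then 1 else 0) ∧
  (∀ u, m.imat 1 0 (e u) = if u ∈ Vc then 1 else 0) ∧
  (∀ u : Vc, m.rmat 0 0 (e u) = g u)

/-- The memory `m` holds the output `f`: it is in row `0` of real matrix `1`. -/
def IsOutput {V : Type*} {n : ℕ} (e : V ≃ Fin n) (f : V → ℝ) (m : Store) : Prop :=
  ∀ u, m.rmat 1 0 (e u) = f u

end Programs

end Gradation

open Gradation

namespace Gradation

/-! ### Balanced extensions -/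

section Balanced

variable {V : Type*}

/-! The optimal greyscale is discretely infinity-harmonic: outside `Vc` each value is the midpoint
of the largest and the smallest value at the neighbours. Such an extension f is a fixed point of a
monotone operator (`exists_balanced`). It is exploited through one principle, `IsBalanced.ascend`:
an edge of slope at least t > 0 whose upper end is not prescribed continues upward by another such
edge, so steep chains end at prescribed vertices. Applied to -f, the same holds downward.

Minimality: suppose that another extension h is nowhere steeper than f on the edges where f has
slope at least t. Comparison along the chains gives f ≤ h at their upper ends and h ≤ f at their
lower ends, so h is not flatter there either (`IsBalanced.slope_le`). Take for t the largest tone on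
an edge where the tones of f and h differ. Then h keeps all f-tones ≥ t, and some edge has tone t
under h but less under f. This gives `IsBalanced.gradation_lt`, hence both minimality and
uniqueness.

Procedure: the invariant `State.Sound` says that the colours are those of f and that f stays
balanced on the current graph. Chains of maximum slope form geodesics between coloured vertices
(`IsBalanced.exists_geodesic`). So the maximum M is the Lipschitz constant of f on the current
graph, f is affine on the geodesics of the steepest pairs, and the colours assigned are right. A
pass deletes only edges of tone 0 or M, and all those of tone M if M > 0; this yields the strictly
decreasing maxima and the gradation vector (`Records`).

Running time: the program computes f without imitating the procedure. In each of n rounds it finds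
all distances by Floyd–Warshall, in the graph of the edges that do not join two coloured vertices,
and colours the geodesics of a single steepest pair. A round either colours a new vertex or finds f
constant along the remaining edges (`IsSteepest.isFlat_or_exists`); in the latter case components
determine f. Correctness and the step bound come from a small precondition calculus
(`exists_runs_of_wp`, `wp_program`). -/

/-- `f` is balanced off `S`: at each vertex outside `S` the steepest ascent and the steepest descent
along the edges of `G` have the same slope. -/
def IsBalanced (G : SimpleGraph V) (S : Set V) (f : V → ℝ) : Prop :=
  ∀ v, v ∉ S → ∀ x, G.Adj v x →
    (∃ y, G.Adj v y ∧ f v - f x ≤ f y - f v) ∧ (∃ y, G.Adj v y ∧ f x - f v ≤ f v - f y)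

theorem IsBalanced.neg {G : SimpleGraph V} {S : Set V} {f : V → ℝ} (hf : IsBalanced G S f) :
    IsBalanced G S (fun v => - f v) := by
  intro v hv x hx
  obtain ⟨⟨y, hy, h1⟩, ⟨z, hz, h2⟩⟩ := hf v hv x hx
  exact ⟨⟨z, hz, by linarith⟩, ⟨y, hy, by linarith⟩⟩

/-- Averaging the supremum and the infimum over the neighbours is monotone on a complete lattice, so
Knaster–Tarski supplies a fixed point. By finiteness both extrema are attained, which turns the
fixed-point equation into balance. -/
theorem exists_balanced [Finite V] (G : SimpleGraph V) {Vc : Set V} (g : Vc → ℝ)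
    (hg : IsIncompleteGreyscale g) :
    ∃ f : V → ℝ, (∀ v, f v ∈ Set.Icc (0 : ℝ) 1) ∧ Compatible g f ∧ IsBalanced G Vc f := by
  classical
  have : Fact ((0 : ℝ) ≤ 1) := ⟨zero_le_one⟩
  let up (h : V → Set.Icc (0 : ℝ) 1) (v : V) : Set.Icc (0 : ℝ) 1 := ⨆ x : {x // G.Adj v x}, h x
  let dn (h : V → Set.Icc (0 : ℝ) 1) (v : V) : Set.Icc (0 : ℝ) 1 := ⨅ x : {x // G.Adj v x}, h x
  let T (h : V → Set.Icc (0 : ℝ) 1) (v : V) : Set.Icc (0 : ℝ) 1 :=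
    if hv : v ∈ Vc then ⟨g ⟨v, hv⟩, hg _⟩ else
      ⟨((up h v : ℝ) + (dn h v : ℝ)) / 2, by
        have h1 := (up h v).2; have h2 := (dn h v).2
        simp only [Set.mem_Icc] at h1 h2 ⊢
        constructor <;> linarith⟩
  have hT : Monotone T := by
    intro h k hk v
    by_cases hv : v ∈ Vc
    · simp [T, hv]
    · have h1 : up h v ≤ up k v := iSup_mono fun x => hk x
      have h2 : dn h v ≤ dn k v := iInf_mono fun x => hk x
      rw [← Subtype.coe_le_coe] at h1 h2 ⊢
      simp only [T, hv, dif_neg, not_false_eq_true]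
      linarith
  let F : (V → Set.Icc (0 : ℝ) 1) →o (V → Set.Icc (0 : ℝ) 1) := ⟨T, hT⟩
  obtain ⟨h, hh⟩ : ∃ h, T h = h := ⟨_, OrderHom.map_lfp F⟩
  refine ⟨fun v => h v, fun v => (h v).2, fun u => ?_, fun v hv x hx => ?_⟩
  · have : T h u = h u := congrFun hh u
    change (h u : ℝ) = g u
    rw [← this]
    simp [T]
  · have e : ((h v : Set.Icc (0 : ℝ) 1) : ℝ) = ((up h v : ℝ) + (dn h v : ℝ)) / 2 := by
      have : T h v = h v := congrFun hh v
      rw [← this]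
      simp [T, hv]
    have l1 : h x ≤ up h v := le_iSup (fun x : {x // G.Adj v x} => h x) ⟨x, hx⟩
    have l2 : dn h v ≤ h x := iInf_le (fun x : {x // G.Adj v x} => h x) ⟨x, hx⟩
    rw [← Subtype.coe_le_coe] at l1 l2
    have : Nonempty {x // G.Adj v x} := ⟨⟨x, hx⟩⟩
    obtain ⟨y, hy⟩ := Finite.exists_max (fun x : {x // G.Adj v x} => h x)
    obtain ⟨z, hz⟩ := Finite.exists_min (fun x : {x // G.Adj v x} => h x)
    have l3 : up h v ≤ h y := iSup_le hy
    have l4 : h z ≤ dn h v := le_iInf hz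
    rw [← Subtype.coe_le_coe] at l3 l4
    exact ⟨⟨y, y.2, by simp only [e] at *; linarith⟩, ⟨z, z.2, by simp only [e] at *; linarith⟩⟩

/-- Ascending induction: a property that holds on `C` and passes down along the edges of slope at
least `t` starting outside `C` holds at the upper end of every edge of slope at least `t`. -/
theorem IsBalanced.ascend [Finite V] {H : SimpleGraph V} {C : Set V} {f : V → ℝ}
    (hf : IsBalanced H C f) {t : ℝ} (ht : 0 < t) {P : V → Prop} (hC : ∀ v ∈ C, P v)
    (hP : ∀ y z, H.Adj y z → t ≤ f z - f y → P z → P y) :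
    ∀ x y, H.Adj x y → t ≤ f y - f x → P y := by
  have key : ∀ y, ∀ x, H.Adj x y → t ≤ f y - f x → P y := by
    intro y
    -- Each continuation raises `f` by at least `t > 0`, so the induction runs from large values of
    -- `f` to small ones.
    have wf : WellFounded (fun a b : V => f b < f a) :=
      have : IsTrans V (fun a b : V => f b < f a) := ⟨fun a b c h1 h2 => h2.trans h1⟩
      have : Std.Irrefl (fun a b : V => f b < f a) := ⟨fun a h => lt_irrefl _ h⟩
      Finite.wellFounded_of_trans_of_irrefl _
    induction y using wf.induction with
    | _ y ih =>
      intro x hxy hx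
      by_cases hy : y ∈ C
      · exact hC y hy
      · obtain ⟨⟨z, hz, hyz⟩, -⟩ := hf y hy x hxy.symm
        have hz' : t ≤ f z - f y := hx.trans hyz
        exact hP y z hz hz' (ih z (by linarith) y hz hz')
  exact fun x y => key y x

/-- On `C` the two maps agree. Going down a steep chain `h` drops no more than `f`, which gives `f ≤
h` at the upper end; the mirrored argument gives `h ≤ f` at the lower end. -/
theorem IsBalanced.slope_le [Finite V] {G : SimpleGraph V} {C : Set V} {f h : V → ℝ}
    (hf : IsBalanced G C f) (hC : ∀ v ∈ C, h v = f v) {t : ℝ} (ht : 0 < t)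
    (hh : ∀ a b, G.Adj a b → t ≤ f b - f a → h b - h a ≤ f b - f a) {x y : V} (hxy : G.Adj x y)
    (hx : t ≤ f y - f x) : f y - f x ≤ h y - h x := by
  have h1 : f y ≤ h y := by
    refine hf.ascend ht (P := fun v => f v ≤ h v) (fun v hv => (hC v hv).ge) ?_ x y hxy hx
    intro y z hyz hs hz
    have := hh y z hyz hs
    linarith
  have h2 : h x ≤ f x := by
    refine hf.neg.ascend ht (P := fun v => h v ≤ f v) (fun v hv => (hC v hv).le) ?_ y x hxy.symm
      (by linarith)
    intro y z hyz hs hz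
    have := hh z y hyz.symm (by linarith)
    linarith
  linarith

end Balanced

/-! ### Lexicographic comparison of gradation vectors -/

section Lex

theorem sort_ge_add (P A : Multiset ℝ) (h : ∀ x ∈ P, ∀ y ∈ A, y ≤ x) :
    (P + A).sort (· ≥ ·) = P.sort (· ≥ ·) ++ A.sort (· ≥ ·) := by
  apply List.Perm.eq_of_pairwise' (r := (· ≥ ·))
  · exact Multiset.pairwise_sort _ _
  · rw [List.pairwise_append]
    refine ⟨Multiset.pairwise_sort _ _, Multiset.pairwise_sort _ _, ?_⟩
    intro a ha b hb
    rw [Multiset.mem_sort] at ha hb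
    exact h a ha b hb
  · rw [← Multiset.coe_eq_coe, ← Multiset.coe_add]
    simp

/-- The entries of `a` that are at least `t` form a common prefix of both sorted lists. Directly
after it `b` has an entry `≥ t`, while `a` has a smaller one or none. -/
theorem sort_lt_sort_of_threshold {ι : Type*} (E : Finset ι) (a b : ι → ℝ) (t : ℝ)
    (h1 : ∀ e ∈ E, t ≤ a e → b e = a e) (h2 : ∀ e ∈ E, a e < t → b e ≤ t)
    (h3 : ∃ e ∈ E, a e < t ∧ b e = t) :
    (E.val.map a).sort (· ≥ ·) < (E.val.map b).sort (· ≥ ·) := by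
  classical
  have hsplit (c : ι → ℝ) : E.val.map c =
      (E.filter (fun e => t ≤ a e)).val.map c + (E.filter (fun e => ¬ t ≤ a e)).val.map c := by
    rw [← Multiset.map_add, Finset.filter_val, Finset.filter_val, Multiset.filter_add_not]
  have hP : (E.filter (fun e => t ≤ a e)).val.map b = (E.filter (fun e => t ≤ a e)).val.map a := by
    apply Multiset.map_congr rfl
    intro e he
    simp only [Finset.mem_val, Finset.mem_filter] at he
    exact h1 e he.1 he.2
  rw [hsplit a, hsplit b, hP, sort_ge_add, sort_ge_add]
  · apply List.append_left_lt
    set A := ((E.filter (fun e => ¬ t ≤ a e)).val.map a).sort (· ≥ ·) with hA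
    set B := ((E.filter (fun e => ¬ t ≤ a e)).val.map b).sort (· ≥ ·) with hB
    have hAt : ∀ x ∈ A, x < t := by
      intro x hx
      simp only [hA, Multiset.mem_sort, Multiset.mem_map, Finset.mem_val, Finset.mem_filter] at hx
      obtain ⟨e, ⟨_, he⟩, rfl⟩ := hx
      exact not_le.1 he
    have htB : t ∈ B := by
      obtain ⟨e, he, hae, hbe⟩ := h3
      simp only [hB, Multiset.mem_sort, Multiset.mem_map, Finset.mem_val, Finset.mem_filter]
      exact ⟨e, ⟨he, not_le.2 hae⟩, hbe⟩
    have hBs : B.Pairwise (· ≥ ·) := Multiset.pairwise_sort _ _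
    clear_value A B
    cases B with
    | nil => simp at htB
    | cons y B =>
      have hy : t ≤ y := by
        rcases List.mem_cons.1 htB with h | h
        · exact h.le
        · exact (List.pairwise_cons.1 hBs).1 t h
      cases A with
      | nil => exact List.nil_lt_cons _ _
      | cons x A => exact List.cons_lt_cons_iff.2 (Or.inl ((hAt x (by simp)).trans_le hy))
  · intro x hx y hy
    simp only [Multiset.mem_map, Finset.mem_val, Finset.mem_filter] at hx hy
    obtain ⟨e, ⟨_, he⟩, rfl⟩ := hx
    obtain ⟨e', ⟨he', hh⟩, rfl⟩ := hy
    exact (h2 e' he' (not_le.1 hh)).trans he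
  · intro x hx y hy
    simp only [Multiset.mem_map, Finset.mem_val, Finset.mem_filter] at hx hy
    obtain ⟨e, ⟨_, he⟩, rfl⟩ := hx
    obtain ⟨e', ⟨he', hh⟩, rfl⟩ := hy
    exact (not_le.1 hh).le.trans he

variable {V : Type*}

@[simp] theorem edgeTone_mk (f : V → ℝ) (u v : V) : edgeTone f s(u, v) = |f u - f v| := rfl

theorem edgeTone_nonneg (f : V → ℝ) (e : Sym2 V) : 0 ≤ edgeTone f e := by
  induction e with
  | _ u v => exact abs_nonneg _

theorem exists_ordered_of_edgeTone {G : SimpleGraph V} (f : V → ℝ) {e : Sym2 V}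
    (he : e ∈ G.edgeSet) :
    ∃ x y, e = s(x, y) ∧ G.Adj x y ∧ edgeTone f e = f y - f x := by
  induction e with
  | _ u v =>
    rcases le_total (f u) (f v) with h | h
    · exact ⟨u, v, rfl, he, by rw [edgeTone_mk, abs_sub_comm, abs_of_nonneg (by linarith)]⟩
    · exact ⟨v, u, Sym2.eq_swap, SimpleGraph.Adj.symm he,
        by rw [edgeTone_mk, abs_of_nonneg (by linarith)]⟩

theorem eq_of_slopes {G : SimpleGraph V} (hG : G.Connected) {f h : V → ℝ} {v₀ : V}
    (h0 : h v₀ = f v₀) (hs : ∀ x y, G.Adj x y → h y - h x = f y - f x) : h = f := by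
  funext v
  obtain ⟨p⟩ := hG.preconnected v v₀
  induction p with
  | nil => exact h0
  | cons hadj p ih => have := hs _ _ hadj; have := ih h0; linarith

/-- A balanced extension has a smaller gradation vector than every other extension. -/
theorem IsBalanced.gradation_lt [Fintype V] {G : SimpleGraph V} (hG : G.Connected) {C : Set V}
    (hC : C.Nonempty) {f h : V → ℝ} (hf : IsBalanced G C f) (hfh : ∀ v ∈ C, h v = f v)
    (hne : h ≠ f) : gradation G f < gradation G h := by
  classical
  have hle : ∀ a b, G.Adj a b → h b - h a ≤ edgeTone h s(a, b) := fun a b _ => by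
    rw [edgeTone_mk, abs_sub_comm]; exact le_abs_self _
  have hpos : ∀ a b, f a ≤ f b → edgeTone f s(a, b) = f b - f a := fun a b hab => by
    rw [edgeTone_mk, abs_sub_comm, abs_of_nonneg (by linarith)]
  by_cases hD : ∀ e ∈ G.edgeSet, edgeTone h e = edgeTone f e
  · exfalso
    obtain ⟨v₀, hv₀⟩ := hC
    apply hne
    -- Equal tones leave only the sign of each slope of `h` open; `slope_le` fixes it.
    have main : ∀ x y, G.Adj x y → f x ≤ f y → h y - h x = f y - f x := by
      intro x y hxy hle'
      have hxy' := hD s(x, y) hxy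
      rcases hle'.eq_or_lt with heq | hlt
      · rw [edgeTone_mk, edgeTone_mk, heq, sub_self, abs_zero, abs_eq_zero] at hxy'
        linarith
      · apply le_antisymm
        · have := hle x y hxy
          rw [hxy', hpos x y hle'] at this
          exact this
        · refine hf.slope_le hfh (sub_pos.2 hlt) ?_ hxy le_rfl
          intro a b hab hs
          have := hle a b hab
          rwa [hD s(a, b) hab, hpos a b (by linarith)] at this
    refine eq_of_slopes hG (hfh v₀ hv₀) fun x y hxy => ?_
    rcases le_total (f x) (f y) with hl | hl
    · exact main x y hxy hl
    · have := main y x hxy.symm hl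
      linarith
  · push Not at hD
    obtain ⟨e₁, he₁, hne₁⟩ := hD
    let D := G.edgeFinset.filter (fun e => edgeTone h e ≠ edgeTone f e)
    have hDmem : ∀ e, e ∈ D ↔ e ∈ G.edgeSet ∧ edgeTone h e ≠ edgeTone f e := by
      intro e; simp [D]
    -- The threshold `t` is the largest tone, under either map, on an edge where the tones differ.
    obtain ⟨e₀, he₀, hmax⟩ := D.exists_max_image (fun e => max (edgeTone f e) (edgeTone h e))
      ⟨e₁, (hDmem _).2 ⟨he₁, hne₁⟩⟩
    set t := max (edgeTone f e₀) (edgeTone h e₀) with ht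
    obtain ⟨he₀, hne₀⟩ := (hDmem _).1 he₀
    have hDle : ∀ e ∈ G.edgeSet, edgeTone h e ≠ edgeTone f e →
        edgeTone f e ≤ t ∧ edgeTone h e ≤ t := fun e he hne =>
      max_le_iff.1 (hmax e ((hDmem e).2 ⟨he, hne⟩))
    have htpos : 0 < t := by
      rcases lt_or_gt_of_ne hne₀ with hlt | hlt
      · exact lt_max_of_lt_left ((edgeTone_nonneg h e₀).trans_lt hlt)
      · exact lt_max_of_lt_right ((edgeTone_nonneg f e₀).trans_lt hlt)
    -- A differing edge with `f`-tone at least `t` would have `f`-tone exactly `t` and `h`-tone at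
    -- most `t`, but `slope_le` forces the latter up to `t`.
    have h1 : ∀ e ∈ G.edgeSet, t ≤ edgeTone f e → edgeTone h e = edgeTone f e := by
      intro e he hte
      by_contra hne'
      obtain ⟨hfe, hhe⟩ := hDle e he hne'
      obtain ⟨x, y, rfl, hxy, hslope⟩ := exists_ordered_of_edgeTone f he
      have := hf.slope_le hfh htpos (fun a b hab hs => by
        by_cases hd : edgeTone h s(a, b) = edgeTone f s(a, b)
        · have := hle a b hab
          rwa [hd, hpos a b (by linarith)] at this
        · exact ((hle a b hab).trans (hDle _ hab hd).2).trans hs) hxy (by linarith)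
      have := hle x y hxy
      exact hne' (by linarith)
    have := sort_lt_sort_of_threshold G.edgeFinset (edgeTone f) (edgeTone h) t
      (fun e he => h1 e (by simpa using he))
      (fun e he hlt => by
        by_cases hd : edgeTone h e = edgeTone f e
        · rw [hd]; exact hlt.le
        · exact (hDle e (by simpa using he) hd).2)
      ⟨e₀, by simpa using he₀, by
        have hlt : edgeTone f e₀ < t := by
          by_contra hcon
          exact hne₀ (h1 e₀ he₀ (not_lt.1 hcon))
        refine ⟨hlt, ?_⟩
        rcases max_choice (edgeTone f e₀) (edgeTone h e₀) with hc | hc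
        · rw [ht, hc] at hlt; exact absurd hlt (lt_irrefl _)
        · rw [ht, hc]⟩
    unfold gradation
    convert this

end Lex

/-! ### Steepest geodesics -/

section Geodesics

variable {V : Type*}

theorem sub_le_mul_length {H : SimpleGraph V} {f : V → ℝ} {M : ℝ}
    (hL : ∀ a b, H.Adj a b → |f a - f b| ≤ M) {u v : V} (p : H.Walk u v) :
    |f u - f v| ≤ M * p.length := by
  induction p with
  | nil => simp
  | cons h p ih =>
    have := hL _ _ h
    have := abs_sub_le (f _) (f _) (f _) |>.trans (add_le_add this ih)
    rw [SimpleGraph.Walk.length_cons]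
    push_cast
    linarith

theorem sub_le_mul_dist {H : SimpleGraph V} {f : V → ℝ} {M : ℝ}
    (hL : ∀ a b, H.Adj a b → |f a - f b| ≤ M) {u v : V} (h : H.Reachable u v) :
    |f u - f v| ≤ M * H.dist u v := by
  obtain ⟨p, hp⟩ := h.exists_walk_length_eq_dist
  rw [← hp]
  exact sub_le_mul_length hL p

theorem mem_geodesicVertices {H : SimpleGraph V} {u v w : V} :
    w ∈ geodesicVertices H u v ↔
      H.Reachable u w ∧ H.Reachable w v ∧ H.dist u w + H.dist w v = H.dist u v := by
  classical
  constructor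
  · rintro ⟨p, hp, hw⟩
    refine ⟨⟨p.takeUntil w hw⟩, ⟨p.dropUntil w hw⟩, le_antisymm ?_ ?_⟩
    · rw [← hp]
      calc _ ≤ (p.takeUntil w hw).length + (p.dropUntil w hw).length :=
            add_le_add (SimpleGraph.dist_le _) (SimpleGraph.dist_le _)
        _ = p.length := by rw [← SimpleGraph.Walk.length_append, p.take_spec]
    · exact (SimpleGraph.Reachable.dist_triangle_left ⟨p.takeUntil w hw⟩ v)
  · rintro ⟨h1, h2, h⟩
    obtain ⟨p, hp⟩ := h1.exists_walk_length_eq_dist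
    obtain ⟨q, hq⟩ := h2.exists_walk_length_eq_dist
    exact ⟨p.append q, by rw [SimpleGraph.Walk.length_append, hp, hq, h], by simp⟩

theorem geodesicVertices_comm (H : SimpleGraph V) (u v : V) :
    geodesicVertices H u v = geodesicVertices H v u := by
  ext w
  rw [mem_geodesicVertices, mem_geodesicVertices, H.dist_comm (u := v) (v := w),
    H.dist_comm (u := w) (v := u), H.dist_comm (u := v) (v := u), H.reachable_comm (u := v) (v := w),
    H.reachable_comm (u := w) (v := u), add_comm]
  tauto

/-- The Lipschitz bounds for the two parts of the geodesic add up to the whole rise, so both are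
equalities. -/
theorem eq_on_geodesicVertices {H : SimpleGraph V} {f : V → ℝ} {M : ℝ}
    (hL : ∀ a b, H.Adj a b → |f a - f b| ≤ M) {u v w : V} (hw : w ∈ geodesicVertices H u v)
    (huv : f v - f u = M * H.dist u v) : f w = f u + H.dist u w * M := by
  obtain ⟨h1, h2, h⟩ := mem_geodesicVertices.1 hw
  have e1 := neg_le_of_abs_le (sub_le_mul_dist hL h1)
  have e2 := neg_le_of_abs_le (sub_le_mul_dist hL h2)
  rw [← h] at huv
  push_cast at huv
  linarith

/-- If the steepest edge of `H` has slope `t > 0`, it lies on a geodesic of constant slope `t` between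
two vertices of `C`. -/
theorem IsBalanced.exists_geodesic [Finite V] {H : SimpleGraph V} {C : Set V} {f : V → ℝ}
    (hf : IsBalanced H C f) {t : ℝ} (ht : 0 < t) (hL : ∀ a b, H.Adj a b → |f a - f b| ≤ t) {x y : V}
    (hxy : H.Adj x y) (hs : f y - f x = t) :
    ∃ u ∈ C, ∃ v ∈ C, H.Reachable u v ∧ u ≠ v ∧ f v - f u = t * H.dist u v ∧
      x ∈ geodesicVertices H u v ∧ y ∈ geodesicVertices H u v := by
  have slope : ∀ a b, H.Adj a b → t ≤ f b - f a → f b - f a = t := fun a b hab h =>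
    le_antisymm (by linarith [neg_le_of_abs_le (hL a b hab)]) h
  obtain ⟨v, hv, q, hq⟩ : ∃ v ∈ C, ∃ q : H.Walk y v, f v = f y + t * q.length := by
    refine hf.ascend ht (P := fun y => ∃ v ∈ C, ∃ q : H.Walk y v, f v = f y + t * q.length)
      (fun v hv => ⟨v, hv, .nil, by simp⟩) ?_ x y hxy hs.ge
    rintro y z hyz hyz' ⟨v, hv, q, hq⟩
    refine ⟨v, hv, .cons hyz q, ?_⟩
    have := slope y z hyz hyz'
    rw [SimpleGraph.Walk.length_cons]
    push_cast
    linarith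
  obtain ⟨u, hu, p, hp⟩ : ∃ u ∈ C, ∃ p : H.Walk u x, f u = f x - t * p.length := by
    refine hf.neg.ascend ht (P := fun x => ∃ u ∈ C, ∃ p : H.Walk u x, f u = f x - t * p.length)
      (fun v hv => ⟨v, hv, .nil, by simp⟩) ?_ y x hxy.symm (by linarith)
    rintro y z hyz hyz' ⟨v, hv, q, hq⟩
    refine ⟨v, hv, q.concat hyz.symm, ?_⟩
    have := slope z y hyz.symm (by linarith)
    rw [SimpleGraph.Walk.length_concat]
    push_cast
    linarith
  -- This walk rises by `t` at every edge, and the Lipschitz bound limits the rise to `t` times the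
  -- distance; hence it is a geodesic.
  let w : H.Walk u v := p.append (.cons hxy q)
  have hw : f v - f u = t * w.length := by
    simp only [w, SimpleGraph.Walk.length_append, SimpleGraph.Walk.length_cons]
    push_cast
    linarith
  have hwpos : 0 < w.length := by simp [w]
  have hd : w.length = H.dist u v := by
    refine le_antisymm ?_ (SimpleGraph.dist_le w)
    have h1 := le_of_abs_le (by simpa [abs_sub_comm] using sub_le_mul_dist hL ⟨w⟩)
    rw [hw] at h1
    exact_mod_cast le_of_mul_le_mul_left h1 ht
  refine ⟨u, hu, v, hv, ⟨w⟩, ?_, by rw [hw, hd], ⟨w, hd, by simp [w]⟩, ⟨w, hd, by simp [w]⟩⟩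
  rintro rfl
  rw [sub_self] at hw
  have : (0 : ℝ) < t * w.length := mul_pos ht (by exact_mod_cast hwpos)
  linarith

/-- A bound for the slopes between the vertices of `C` bounds the slopes of all edges. -/
theorem IsBalanced.lipschitz [Finite V] {H : SimpleGraph V} {C : Set V} {f : V → ℝ}
    (hf : IsBalanced H C f) {M : ℝ} (hM0 : 0 ≤ M)
    (hM : ∀ u ∈ C, ∀ v ∈ C, H.Reachable u v → f v - f u ≤ M * H.dist u v) {x y : V}
    (hxy : H.Adj x y) : |f x - f y| ≤ M := by
  classical
  have := Fintype.ofFinite V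
  obtain ⟨⟨⟨a, b⟩, hab⟩, hmax⟩ :=
    have : Nonempty {p : V × V // H.Adj p.1 p.2} := ⟨⟨(x, y), hxy⟩⟩
    Finite.exists_max (fun p : {p : V × V // H.Adj p.1 p.2} => f p.1.2 - f p.1.1)
  simp only [Subtype.forall, Prod.forall] at hmax
  have hL : ∀ c d, H.Adj c d → |f c - f d| ≤ f b - f a := fun c d hcd =>
    abs_le.2 ⟨by linarith [hmax c d hcd], by linarith [hmax d c hcd.symm]⟩
  refine (hL x y hxy).trans ?_
  rcases le_or_gt (f b - f a) 0 with h0 | h0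
  · exact h0.trans hM0
  · obtain ⟨u, hu, v, hv, hr, hne, heq, -, -⟩ := hf.exists_geodesic h0 hL hab rfl
    have h1 := hM u hu v hv hr
    rw [heq] at h1
    exact le_of_mul_le_mul_right h1 (by exact_mod_cast hr.pos_dist_of_ne hne)

end Geodesics

/-! ### Correctness of the procedure -/

section Procedure

variable {V : Type*}

/-- The invariant of the procedure, relative to a balanced extension `f`. -/
structure State.Sound (σ : State V) (f : V → ℝ) : Prop where
  tone_eq : ∀ v ∈ σ.coloured, σ.tone v = f v
  balanced : IsBalanced σ.graph σ.coloured f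
  reach : ∀ v, ∃ u ∈ σ.coloured, σ.graph.Reachable v u

theorem IsInitial.sound {G : SimpleGraph V} (hG : G.Connected) {Vc : Set V} {g : Vc → ℝ}
    {f : V → ℝ} (hne : Vc.Nonempty) (hfg : Compatible g f) (hf : IsBalanced G Vc f) {σ : State V}
    (h : IsInitial G g σ) : σ.Sound f := by
  obtain ⟨h1, h2, h3⟩ := h
  obtain ⟨u, hu⟩ := hne
  constructor
  · intro v hv
    rw [h2] at hv
    exact (h3 ⟨v, hv⟩).trans (hfg ⟨v, hv⟩).symm
  · rwa [h1, h2]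
  · intro v
    rw [h1, h2]
    exact ⟨u, hu, hG.preconnected v u⟩

theorem State.Sound.exists_step [Finite V] {σ : State V} {f : V → ℝ} (hσ : σ.Sound f) :
    ∃ (o : Option ℝ) (σ' : State V), Step σ o σ' := by
  classical
  have := Fintype.ofFinite V
  by_cases hp : σ.pairs.Nonempty
  · obtain ⟨p, hp, hmax⟩ := Set.exists_max_image σ.pairs
      (fun p => colourIncrease σ.graph σ.tone p.1 p.2) σ.pairs.toFinite hp
    set M := colourIncrease σ.graph σ.tone p.1 p.2 with hM
    have hsymm : ∀ u v, ((u, v) ∈ σ.pairs ∧ colourIncrease σ.graph σ.tone u v = M) ↔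
        ((v, u) ∈ σ.pairs ∧ colourIncrease σ.graph σ.tone v u = M) := by
      intro u v
      simp only [State.pairs, colourIncrease, Set.mem_ofPred_eq]
      rw [abs_sub_comm, SimpleGraph.dist_comm, SimpleGraph.reachable_comm, ne_comm]
      tauto
    -- Working in `Sym2` and choosing a representative of each element keeps a pair from being
    -- listed in both orders.
    let S : Finset (Sym2 V) := (Finset.univ.filter fun q : V × V =>
      q ∈ σ.pairs ∧ colourIncrease σ.graph σ.tone q.1 q.2 = M).image fun q => s(q.1, q.2)
    have hS : ∀ u v, s(u, v) ∈ S ↔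
        ((u, v) ∈ σ.pairs ∧ colourIncrease σ.graph σ.tone u v = M) := by
      intro u v
      simp only [S, Finset.mem_image, Finset.mem_filter, Finset.mem_univ, true_and, Prod.exists]
      constructor
      · rintro ⟨a, b, h, hab⟩
        rcases Sym2.eq_iff.1 hab with ⟨rfl, rfl⟩ | ⟨rfl, rfl⟩
        · exact h
        · exact (hsymm _ _).1 h
      · exact fun h => ⟨u, v, h, rfl⟩
    have hout : ∀ z : Sym2 V, s((Quot.out z).1, (Quot.out z).2) = z := fun z => Quot.out_eq z
    refine ⟨some M, _, .geodesics σ M (S.toList.map Quot.out) ⟨⟨p, hp, rfl⟩, ?_⟩ ⟨?_, ?_⟩⟩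
    · rintro _ ⟨q, hq, rfl⟩
      exact hmax q hq
    · rw [List.map_map]
      have : ((fun p : V × V => s(p.1, p.2)) ∘ Quot.out) = (id : Sym2 V → Sym2 V) := funext hout
      rw [this, List.map_id]
      exact S.nodup_toList
    · intro u v
      rw [← hS]
      simp only [List.mem_map, Finset.mem_toList]
      constructor
      · rintro (⟨z, hz, h⟩ | ⟨z, hz, h⟩)
        · rwa [← hout z, h] at hz
        · rw [← hout z, h] at hz
          rwa [Sym2.eq_swap]
      · intro h
        have := hout s(u, v)
        rcases Sym2.eq_iff.1 this with ⟨h1, h2⟩ | ⟨h1, h2⟩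
        · exact Or.inl ⟨_, h, Prod.ext h1 h2⟩
        · exact Or.inr ⟨_, h, Prod.ext h1 h2⟩
  · choose c hc using hσ.reach
    refine ⟨none, _, .components σ c fun w x => ⟨?_, ?_⟩⟩
    · rintro ⟨hx, hwx⟩
      by_contra hne
      exact hp ⟨(x, c w), hne, hx, (hc w).1, hwx.symm.trans (hc w).2⟩
    · rintro rfl
      exact hc w

theorem State.Sound.colourIncrease_eq {σ : State V} {f : V → ℝ} (hσ : σ.Sound f) {u v : V}
    (h : (u, v) ∈ σ.pairs) : colourIncrease σ.graph σ.tone u v = |f u - f v| / σ.graph.dist u v := by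
  rw [colourIncrease, hσ.tone_eq u h.2.1, hσ.tone_eq v h.2.2.1]

theorem State.dist_pos_of_mem_pairs {σ : State V} {u v : V} (h : (u, v) ∈ σ.pairs) :
    (0 : ℝ) < σ.graph.dist u v := by
  exact_mod_cast h.2.2.2.pos_dist_of_ne h.1

theorem State.IsMaxIncrease.nonneg {σ : State V} {M : ℝ} (hM : σ.IsMaxIncrease M) : 0 ≤ M := by
  obtain ⟨⟨p, -, rfl⟩, -⟩ := hM
  exact div_nonneg (abs_nonneg _) (Nat.cast_nonneg _)

theorem State.Sound.lipschitz [Finite V] {σ : State V} {f : V → ℝ} (hσ : σ.Sound f) {M : ℝ}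
    (hM : σ.IsMaxIncrease M) : ∀ a b, σ.graph.Adj a b → |f a - f b| ≤ M := by
  intro a b hab
  refine hσ.balanced.lipschitz hM.nonneg ?_ hab
  intro u hu v hv huv
  by_cases hne : u = v
  · subst hne; simp
  · have hp : (u, v) ∈ σ.pairs := ⟨hne, hu, hv, huv⟩
    have h1 := hM.2 ⟨_, hp, rfl⟩
    simp only [hσ.colourIncrease_eq hp] at h1
    rw [div_le_iff₀ (State.dist_pos_of_mem_pairs hp), abs_sub_comm] at h1
    exact (le_abs_self _).trans h1

/-- The colour that a steepest pair gives to the vertices of its geodesics is the right one. -/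
theorem State.Sound.colourGeodesics_eq [Finite V] {σ : State V} {f : V → ℝ} (hσ : σ.Sound f) {M : ℝ}
    (hM : σ.IsMaxIncrease M) {p : V × V} (hp : p ∈ σ.pairs)
    (hpM : colourIncrease σ.graph σ.tone p.1 p.2 = M) {t : V → ℝ} (h1 : t p.1 = f p.1)
    (h2 : t p.2 = f p.2) {w : V} (hw : w ∈ geodesicVertices σ.graph p.1 p.2) :
    colourGeodesics σ.graph M t p w = f w := by
  obtain ⟨u, v⟩ := p
  have hd := State.dist_pos_of_mem_pairs hp
  rw [hσ.colourIncrease_eq hp, div_eq_iff hd.ne'] at hpM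
  simp only [colourGeodesics, hw, if_true, h1, h2]
  simp only at hw hpM
  split_ifs with hle
  · rw [eq_on_geodesicVertices (hσ.lipschitz hM) hw, σ.graph.dist_comm]
    rw [← hpM, abs_sub_comm, abs_of_nonneg (by linarith)]
  · rw [geodesicVertices_comm] at hw
    rw [eq_on_geodesicVertices (hσ.lipschitz hM) hw, σ.graph.dist_comm]
    rw [σ.graph.dist_comm, ← hpM, abs_of_nonneg (by linarith)]

/-- Later pairs may overwrite colours given by earlier ones. This is harmless: the ends of every
pair were coloured before the pass, so they carry the values of `f` whenever the pair is treated,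
and only values of `f` are written. -/
theorem State.Sound.foldl_colourGeodesics [Finite V] {σ : State V} {f : V → ℝ} (hσ : σ.Sound f)
    {M : ℝ} (hM : σ.IsMaxIncrease M) (L : List (V × V))
    (hL : ∀ p ∈ L, p ∈ σ.pairs ∧ colourIncrease σ.graph σ.tone p.1 p.2 = M) (S : Set V)
    (hS : σ.coloured ⊆ S) (t : V → ℝ) (ht : ∀ v ∈ S, t v = f v) :
    ∀ v ∈ S ∪ {w | ∃ p ∈ L, w ∈ geodesicVertices σ.graph p.1 p.2},
      L.foldl (colourGeodesics σ.graph M) t v = f v := by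
  induction L generalizing S t with
  | nil =>
    rintro v (hv | ⟨p, hp, -⟩)
    · exact ht v hv
    · simp at hp
  | cons p L ih =>
    rintro v hv
    obtain ⟨hp, hpM⟩ := hL p (by simp)
    refine ih (fun q hq => hL q (by simp [hq])) (S ∪ geodesicVertices σ.graph p.1 p.2)
      (hS.trans Set.subset_union_left) _ ?_ v ?_
    · intro w hw
      by_cases hwp : w ∈ geodesicVertices σ.graph p.1 p.2
      · exact hσ.colourGeodesics_eq hM hp hpM (ht _ (hS hp.2.1)) (ht _ (hS hp.2.2.1)) hwp
      · simp only [colourGeodesics, hwp, if_false]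
        exact ht w (hw.resolve_right hwp)
    · rcases hv with hv | ⟨q, hq, hvq⟩
      · exact Or.inl (Or.inl hv)
      · rcases List.mem_cons.1 hq with rfl | hq
        · exact Or.inl (Or.inr hvq)
        · exact Or.inr ⟨q, hq, hvq⟩

theorem State.Lists.mem {σ : State V} {M : ℝ} {L : List (V × V)} (hL : σ.Lists M L) :
    ∀ p ∈ L, p ∈ σ.pairs ∧ colourIncrease σ.graph σ.tone p.1 p.2 = M :=
  fun p hp => (hL.2 p.1 p.2).1 (Or.inl hp)

theorem left_mem_geodesicVertices {H : SimpleGraph V} {u v : V} (h : H.Reachable u v) :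
    u ∈ geodesicVertices H u v :=
  mem_geodesicVertices.2 ⟨.refl _, h, by simp⟩

theorem exists_adj_mem_geodesicVertices {H : SimpleGraph V} {u v : V} (h : H.Reachable u v)
    (hne : u ≠ v) : ∃ w, H.Adj u w ∧ w ∈ geodesicVertices H u v := by
  obtain ⟨p, hp⟩ := h.exists_walk_length_eq_dist
  cases p with
  | nil => exact absurd rfl hne
  | cons hadj q => exact ⟨_, hadj, _, hp, by simp⟩

/-- Up to its first vertex in `C`, the walk uses only edges with an end outside `C`, and these
survive in `H'`. -/
theorem reachable_first {H H' : SimpleGraph V} {C : Set V}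
    (hH : ∀ a b, H.Adj a b → ¬ (a ∈ C ∧ b ∈ C) → H'.Adj a b) {v u : V} (p : H.Walk v u)
    (hu : u ∈ C) : ∃ x ∈ C, H'.Reachable v x := by
  induction p with
  | nil => exact ⟨_, hu, .refl _⟩
  | @cons a b _ hadj p ih =>
    by_cases ha : a ∈ C
    · exact ⟨a, ha, .refl _⟩
    · obtain ⟨x, hx, hr⟩ := ih hu
      exact ⟨x, hx, (hH a b hadj fun h => ha h.1).reachable.trans hr⟩

/-- Deleted edges have both ends coloured afterwards. So a vertex that remains uncoloured keeps all
its edges, and with them its balance. In the other case no two distinct coloured vertices share a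
component, so `f` has Lipschitz constant 0. -/
theorem State.Sound.step [Finite V] {σ σ' : State V} {o : Option ℝ} {f : V → ℝ} (hσ : σ.Sound f)
    (h : Step σ o σ') : σ'.Sound f := by
  cases h with
  | geodesics M L hM hL =>
    have hadj : ∀ a b, σ.graph.Adj a b →
        ¬ (a ∈ σ.coloured ∪ {w | ∃ p ∈ L, w ∈ geodesicVertices σ.graph p.1 p.2} ∧
          b ∈ σ.coloured ∪ {w | ∃ p ∈ L, w ∈ geodesicVertices σ.graph p.1 p.2}) →
        (σ.graph.deleteEdges
            {e | ∃ p ∈ L, ∀ w ∈ e, w ∈ geodesicVertices σ.graph p.1 p.2}).Adj a b := by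
      intro a b hab hn
      rw [SimpleGraph.deleteEdges_adj]
      refine ⟨hab, ?_⟩
      rintro ⟨p, hp, hw⟩
      exact hn ⟨Or.inr ⟨p, hp, hw a (by simp)⟩, Or.inr ⟨p, hp, hw b (by simp)⟩⟩
    constructor
    · exact hσ.foldl_colourGeodesics hM L hL.mem _ subset_rfl _ hσ.tone_eq
    · intro v hv x hx
      simp only at hv hx ⊢
      obtain ⟨⟨y, hy, h1⟩, ⟨z, hz, h2⟩⟩ := hσ.balanced v (fun h => hv (Or.inl h)) x
        (SimpleGraph.deleteEdges_adj.1 hx).1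
      exact ⟨⟨y, hadj v y hy fun h => hv h.1, h1⟩, ⟨z, hadj v z hz fun h => hv h.1, h2⟩⟩
    · intro v
      obtain ⟨u, hu, ⟨p⟩⟩ := hσ.reach v
      exact reachable_first hadj p (Or.inl hu)
  | components c hc =>
    have hconst : ∀ a b, σ.graph.Adj a b → |f a - f b| ≤ 0 := by
      intro a b hab
      refine hσ.balanced.lipschitz le_rfl ?_ hab
      intro u hu v hv huv
      rw [(hc u u).1 ⟨hu, .refl _⟩, ← (hc u v).1 ⟨hv, huv⟩]
      simp
    refine ⟨fun v _ => ?_, fun v hv => absurd (Set.mem_univ v) hv,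
      fun v => ⟨v, Set.mem_univ v, .refl _⟩⟩
    obtain ⟨h1, h2⟩ := (hc v (c v)).2 rfl
    have := sub_le_mul_dist hconst h2
    rw [zero_mul] at this
    simp only [hσ.tone_eq _ h1]
    linarith [abs_le.1 this]

theorem Exec.sound [Finite V] {guard : State V → Prop} {G : SimpleGraph V} (hG : G.Connected)
    {Vc : Set V} {g : Vc → ℝ} {f : V → ℝ} (hne : Vc.Nonempty) (hfg : Compatible g f)
    (hf : IsBalanced G Vc f) {l : List (Option ℝ)} {σ : State V} (h : Exec guard G g l σ) :
    σ.Sound f := by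
  induction h with
  | start σ h => exact h.sound hG hne hfg hf
  | step l σ o σ' h hg hs ih => exact ih.step hs

/-! ### The number of passes -/

theorem Step.graph_le {σ σ' : State V} {o : Option ℝ} (h : Step σ o σ') : σ'.graph ≤ σ.graph := by
  cases h with
  | geodesics M L hM hL => exact SimpleGraph.deleteEdges_le _
  | components c hc => exact le_rfl

/-- The first edge of a geodesic of a steepest pair has both ends in the geodesic set and is
deleted. -/
theorem Step.ncard_lt [Finite V] {σ σ' : State V} {M : ℝ} (h : Step σ (some M) σ') :
    σ'.graph.edgeSet.ncard < σ.graph.edgeSet.ncard := by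
  cases h with
  | geodesics _ L hM hL =>
    refine Set.ncard_lt_ncard ⟨SimpleGraph.edgeSet_subset_edgeSet.2 (SimpleGraph.deleteEdges_le _),
      ?_⟩ (Set.toFinite _)
    intro hsub
    obtain ⟨⟨⟨u, v⟩, hp, hpM⟩, -⟩ := hM
    have key : ∀ u v, (u, v) ∈ σ.pairs → (u, v) ∉ L := by
      intro u v hp huv
      obtain ⟨w, hadj, hw⟩ := exists_adj_mem_geodesicVertices hp.2.2.2 hp.1
      have := hsub (show s(u, w) ∈ σ.graph.edgeSet from hadj)
      rw [SimpleGraph.edgeSet_deleteEdges] at this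
      refine this.2 ⟨(u, v), huv, fun x hx => ?_⟩
      rcases Sym2.mem_iff.1 hx with rfl | rfl
      · exact left_mem_geodesicVertices hp.2.2.2
      · exact hw
    have hp' : (v, u) ∈ σ.pairs := ⟨hp.1.symm, hp.2.2.1, hp.2.1, hp.2.2.2.symm⟩
    rcases (hL.2 u v).2 ⟨hp, hpM⟩ with h | h
    · exact key u v hp h
    · exact key v u hp' h

theorem Exec.length_le_of_vertexLeft [Finite V] {G : SimpleGraph V} {Vc : Set V} {g : Vc → ℝ}
    {l : List (Option ℝ)} {σ : State V} (h : Exec VertexLeft G g l σ) :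
    l.length ≤ G.edgeSet.ncard := by
  suffices l.length + σ.graph.edgeSet.ncard ≤ G.edgeSet.ncard ∨
      (σ.coloured = Set.univ ∧ l.length ≤ G.edgeSet.ncard) by omega
  induction h with
  | start σ h => left; simp [h.1]
  | step l σ o σ' h hg hs ih =>
    have ih := ih.resolve_right fun h => hg h.1
    rw [List.length_append, List.length_singleton]
    cases o with
    | some M => left; have := hs.ncard_lt; omega
    | none =>
      right
      cases hs with
      | components c hc =>
        refine ⟨rfl, ?_⟩
        obtain ⟨w, hw⟩ := (Set.ne_univ_iff_exists_notMem _).1 hg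
        obtain ⟨h1, ⟨p⟩⟩ := (hc w (c w)).2 rfl
        -- An uncoloured vertex is joined to a coloured one by a nontrivial walk; the edge left over
        -- pays for the final pass.
        have : σ.graph.edgeSet.Nonempty := by
          revert h1
          generalize c w = x at p
          intro h1
          cases p with
          | nil => exact absurd h1 hw
          | cons hadj _ => exact ⟨s(_, _), hadj⟩
        have := (Set.ncard_pos (Set.toFinite _)).2 this
        omega

theorem Exec.length_le_of_edgeLeft [Finite V] {G : SimpleGraph V} {Vc : Set V} {g : Vc → ℝ}
    {l : List (Option ℝ)} {σ : State V} (h : Exec EdgeLeft G g l σ) :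
    l.length ≤ G.edgeSet.ncard + 1 := by
  suffices l.length + σ.graph.edgeSet.ncard ≤ G.edgeSet.ncard ∨
      (σ.coloured = Set.univ ∧ l.length + σ.graph.edgeSet.ncard ≤ G.edgeSet.ncard + 1) by omega
  induction h with
  | start σ h => left; simp [h.1]
  | step l σ o σ' h hg hs ih =>
    rw [List.length_append, List.length_singleton]
    cases o with
    | some M =>
      have := hs.ncard_lt
      refine ih.imp (fun _ => by omega) fun ih => ⟨?_, by omega⟩
      cases hs with
      | geodesics _ L hM hL => simp [ih.1]
    | none =>
      right
      cases hs with
      | components c hc =>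
        refine ⟨rfl, ?_⟩
        rcases ih with ih | ⟨hu, -⟩
        · simp only; omega
        · exfalso
          obtain ⟨a, b, hab⟩ := SimpleGraph.ne_bot_iff_exists_adj.1 hg
          have h1 := (hc a a).1 ⟨hu ▸ Set.mem_univ a, .refl _⟩
          have h2 := (hc a b).1 ⟨hu ▸ Set.mem_univ b, hab.reachable⟩
          exact hab.ne (h1.trans h2.symm)

/-! ### The maxima and the gradation vector -/

/-- `Ms` and `z` record the positive maxima and the number of the zero maxima in `l`; the tones of
the deleted edges are `0` or members of `Ms`, those of the other edges are smaller. -/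
structure Records (G : SimpleGraph V) (f : V → ℝ) (l : List (Option ℝ)) (σ : State V) (Ms : List ℝ)
    (z : ℕ) : Prop where
  labels : l.reduceOption = Ms ++ List.replicate z 0
  decreasing : Ms.Pairwise (· > ·)
  pos : ∀ M ∈ Ms, 0 < M
  attained : ∀ M ∈ Ms, ∃ e ∈ G.edgeSet, edgeTone f e = M
  deleted : ∀ e ∈ G.edgeSet, e ∉ σ.graph.edgeSet → edgeTone f e = 0 ∨ edgeTone f e ∈ Ms
  lt : ∀ M ∈ Ms, ∀ e ∈ σ.graph.edgeSet, edgeTone f e < M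
  zero : z ≠ 0 → ∀ e ∈ σ.graph.edgeSet, edgeTone f e = 0

/-- No tone exceeds `M`, and if all tones were below `M`, so would be the slope of the steepest
pair. -/
theorem State.Sound.attained [Finite V] {σ : State V} {f : V → ℝ} (hσ : σ.Sound f) {M : ℝ}
    (hM : σ.IsMaxIncrease M) : ∃ e ∈ σ.graph.edgeSet, edgeTone f e = M := by
  obtain ⟨⟨⟨u, v⟩, hp, hpM⟩, -⟩ := id hM
  have hd := State.dist_pos_of_mem_pairs hp
  simp only [hσ.colourIncrease_eq hp] at hpM
  obtain ⟨w, hw, -⟩ := exists_adj_mem_geodesicVertices hp.2.2.2 hp.1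
  obtain ⟨e, he, hmax⟩ := Set.exists_max_image σ.graph.edgeSet (edgeTone f) (Set.toFinite _)
    ⟨s(u, w), hw⟩
  refine ⟨e, he, le_antisymm ?_ ?_⟩
  · have hL := hσ.lipschitz hM
    induction e with
    | _ a b => exact hL a b he
  · have := sub_le_mul_dist (f := f) (fun a b hab => hmax s(a, b) hab) hp.2.2.2
    rw [← hpM]
    exact (div_le_iff₀ hd).2 this

/-- On the geodesics `f` is affine in the distance from the lower end, and the distances of adjacent
vertices differ by at most 1. -/
theorem State.Sound.tone_deleted [Finite V] {σ : State V} {f : V → ℝ} (hσ : σ.Sound f) {M : ℝ}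
    (hM : σ.IsMaxIncrease M) {u v : V} (hp : (u, v) ∈ σ.pairs)
    (hpM : colourIncrease σ.graph σ.tone u v = M) {e : Sym2 V} (he : e ∈ σ.graph.edgeSet)
    (hw : ∀ w ∈ e, w ∈ geodesicVertices σ.graph u v) : edgeTone f e = 0 ∨ edgeTone f e = M := by
  have hM0 := hM.nonneg
  have hL := hσ.lipschitz hM
  induction e with
  | _ a b =>
    have key : ∀ u v, f u ≤ f v → (u, v) ∈ σ.pairs → |f u - f v| / σ.graph.dist u v = M →
        (∀ w ∈ s(a, b), w ∈ geodesicVertices σ.graph u v) → |f a - f b| = 0 ∨ |f a - f b| = M := by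
      intro u v huv hp hpM hw
      rw [div_eq_iff (State.dist_pos_of_mem_pairs hp).ne', abs_sub_comm,
        abs_of_nonneg (by linarith)] at hpM
      have ha := hw a (by simp)
      have hb := hw b (by simp)
      rw [eq_on_geodesicVertices hL ha hpM, eq_on_geodesicVertices hL hb hpM]
      have hab : σ.graph.Adj a b := he
      have h1 : σ.graph.dist u b ≤ σ.graph.dist u a + 1 := by
        rw [← SimpleGraph.dist_eq_one_iff_adj.2 hab]
        exact (mem_geodesicVertices.1 ha).1.dist_triangle_left b
      have h2 : σ.graph.dist u a ≤ σ.graph.dist u b + 1 := by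
        rw [← SimpleGraph.dist_eq_one_iff_adj.2 hab.symm]
        exact (mem_geodesicVertices.1 hb).1.dist_triangle_left a
      rcases (by omega : σ.graph.dist u a = σ.graph.dist u b ∨
        σ.graph.dist u a = σ.graph.dist u b + 1 ∨ σ.graph.dist u b = σ.graph.dist u a + 1)
        with h | h | h <;> rw [h]
      · left; simp
      · right
        push_cast
        rw [← abs_of_nonneg hM0]
        congr 1
        rw [abs_of_nonneg hM0]
        ring
      · right
        push_cast
        rw [abs_sub_comm, ← abs_of_nonneg hM0]
        congr 1
        rw [abs_of_nonneg hM0]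
        ring
    rw [hσ.colourIncrease_eq hp] at hpM
    rw [edgeTone_mk]
    rcases le_total (f u) (f v) with h | h
    · exact key u v h hp hpM hw
    · refine key v u h ⟨hp.1.symm, hp.2.2.1, hp.2.1, hp.2.2.2.symm⟩ ?_ ?_
      · rw [abs_sub_comm, SimpleGraph.dist_comm, hpM]
      · simpa only [geodesicVertices_comm σ.graph v u] using hw

/-- All edges of maximum tone lie on the geodesics of one of the listed pairs. -/
theorem State.Sound.tone_lt [Finite V] {σ : State V} {f : V → ℝ} (hσ : σ.Sound f) {M : ℝ}
    (hM : σ.IsMaxIncrease M) (hpos : 0 < M) {L : List (V × V)} (hL : σ.Lists M L) {e : Sym2 V}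
    (he : e ∈ σ.graph.edgeSet)
    (hn : ¬ ∃ p ∈ L, ∀ w ∈ e, w ∈ geodesicVertices σ.graph p.1 p.2) : edgeTone f e < M := by
  have hlip := hσ.lipschitz hM
  obtain ⟨x, y, rfl, hxy, hs⟩ := exists_ordered_of_edgeTone f he
  refine lt_of_le_of_ne (hlip x y hxy) fun heq => hn ?_
  obtain ⟨u, hu, v, hv, hr, hne, hslope, hx, hy⟩ :=
    hσ.balanced.exists_geodesic hpos hlip hxy (hs.symm.trans heq)
  have hp : (u, v) ∈ σ.pairs := ⟨hne, hu, hv, hr⟩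
  have hpM : colourIncrease σ.graph σ.tone u v = M := by
    rw [hσ.colourIncrease_eq hp, div_eq_iff (State.dist_pos_of_mem_pairs hp).ne', abs_sub_comm,
      hslope, abs_of_nonneg (by positivity)]
  have hmem : ∀ w ∈ s(x, y), w ∈ geodesicVertices σ.graph u v := by
    intro w hw
    rcases Sym2.mem_iff.1 hw with rfl | rfl
    · exact hx
    · exact hy
  rcases (hL.2 u v).2 ⟨hp, hpM⟩ with h | h
  · exact ⟨_, h, hmem⟩
  · refine ⟨_, h, ?_⟩
    simpa only [geodesicVertices_comm σ.graph v u] using hmem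

theorem Records.step [Finite V] {G : SimpleGraph V} {f : V → ℝ} {l : List (Option ℝ)}
    {σ σ' : State V} {o : Option ℝ} {Ms : List ℝ} {z : ℕ} (hr : Records G f l σ Ms z)
    (hσ : σ.Sound f) (hG : σ.graph ≤ G) (hs : Step σ o σ') :
    ∃ Ms z, Records G f (l ++ [o]) σ' Ms z := by
  have hsub : ∀ e ∈ σ'.graph.edgeSet, e ∈ σ.graph.edgeSet := fun e he =>
    SimpleGraph.edgeSet_subset_edgeSet.2 hs.graph_le he
  cases hs with
  | components c hc =>
    refine ⟨Ms, z, ?_, hr.decreasing, hr.pos, hr.attained, hr.deleted, hr.lt, hr.zero⟩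
    rw [List.reduceOption_append, hr.labels]
    simp
  | geodesics M L hM hL =>
    have hdel : ∀ e ∈ σ.graph.edgeSet, e ∉ (σ.graph.deleteEdges
        {e | ∃ p ∈ L, ∀ w ∈ e, w ∈ geodesicVertices σ.graph p.1 p.2}).edgeSet →
        edgeTone f e = 0 ∨ edgeTone f e = M := by
      intro e he hn
      rw [SimpleGraph.edgeSet_deleteEdges] at hn
      have : ∃ p ∈ L, ∀ w ∈ e, w ∈ geodesicVertices σ.graph p.1 p.2 := by
        by_contra hcon
        exact hn ⟨he, hcon⟩
      obtain ⟨p, hp, hw⟩ := this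
      obtain ⟨h1, h2⟩ := hL.mem p hp
      exact hσ.tone_deleted hM h1 h2 he hw
    obtain ⟨e₀, he₀, hM₀⟩ := hσ.attained hM
    rcases hM.nonneg.eq_or_lt with rfl | hpos
    · have hz : ∀ e ∈ σ.graph.edgeSet, edgeTone f e = 0 := by
        intro e he
        have hlip := hσ.lipschitz hM
        induction e with
        | _ a b => exact le_antisymm (hlip a b he) (edgeTone_nonneg _ _)
      refine ⟨Ms, z + 1, ?_, hr.decreasing, hr.pos, hr.attained, ?_, ?_, ?_⟩
      · rw [List.reduceOption_append, hr.labels, List.replicate_succ', List.append_assoc]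
        simp
      · intro e he hn
        by_cases he' : e ∈ σ.graph.edgeSet
        · exact Or.inl (hz e he')
        · exact hr.deleted e he he'
      · exact fun M hM e he => hr.lt M hM e (hsub e he)
      · exact fun _ e he => hz e (hsub e he)
    · have hz : z = 0 := by
        by_contra hz
        rw [hr.zero hz e₀ he₀] at hM₀
        exact hpos.ne hM₀
      subst hz
      have hlt : ∀ e ∈ (σ.graph.deleteEdges
        {e | ∃ p ∈ L, ∀ w ∈ e, w ∈ geodesicVertices σ.graph p.1 p.2}).edgeSet,
          edgeTone f e < M := by
        intro e he
        rw [SimpleGraph.edgeSet_deleteEdges] at he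
        exact hσ.tone_lt hM hpos hL he.1 he.2
      refine ⟨Ms ++ [M], 0, ?_, ?_, ?_, ?_, ?_, ?_, fun h => absurd rfl h⟩
      · rw [List.reduceOption_append, hr.labels]
        simp
      · rw [List.pairwise_append]
        refine ⟨hr.decreasing, List.pairwise_singleton _ _, ?_⟩
        intro M' hM' x hx
        rw [List.mem_singleton.1 hx, ← hM₀]
        exact hr.lt M' hM' e₀ he₀
      · intro M' hM'
        rcases List.mem_append.1 hM' with h | h
        · exact hr.pos M' h
        · rwa [List.mem_singleton.1 h]
      · intro M' hM'
        rcases List.mem_append.1 hM' with h | h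
        · exact hr.attained M' h
        · rw [List.mem_singleton.1 h]
          exact ⟨e₀, SimpleGraph.edgeSet_subset_edgeSet.2 hG he₀, hM₀⟩
      · intro e he hn
        rw [List.mem_append, List.mem_singleton]
        by_cases he' : e ∈ σ.graph.edgeSet
        · have := hdel e he' hn
          tauto
        · have := hr.deleted e he he'
          tauto
      · intro M' hM' e he
        rcases List.mem_append.1 hM' with h | h
        · exact hr.lt M' h e (hsub e he)
        · rw [List.mem_singleton.1 h]
          exact hlt e he

theorem Exec.graph_le {guard : State V → Prop} {G : SimpleGraph V} {Vc : Set V} {g : Vc → ℝ}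
    {l : List (Option ℝ)} {σ : State V} (h : Exec guard G g l σ) : σ.graph ≤ G := by
  induction h with
  | start σ h => exact h.1.le
  | step l σ o σ' h hg hs ih => exact hs.graph_le.trans ih

theorem Exec.exists_records [Finite V] {guard : State V → Prop} {G : SimpleGraph V}
    (hG : G.Connected) {Vc : Set V} {g : Vc → ℝ} {f : V → ℝ} (hne : Vc.Nonempty)
    (hfg : Compatible g f) (hf : IsBalanced G Vc f) {l : List (Option ℝ)} {σ : State V}
    (h : Exec guard G g l σ) : ∃ Ms z, Records G f l σ Ms z := by
  induction h with
  | start σ h =>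
    refine ⟨[], 0, rfl, List.Pairwise.nil, by simp, by simp, ?_, by simp, by simp⟩
    intro e he hn
    rw [h.1] at hn
    exact absurd he hn
  | step l σ o σ' h hg hs ih =>
    obtain ⟨Ms, z, hr⟩ := ih
    exact hr.step (h.sound hG hne hfg hf) h.graph_le hs

/-- A sorted list with entries in `Ms ∪ {0}` lists the members of `Ms` with their multiplicities. -/
theorem sort_eq_flatten (A : Multiset ℝ) (Ms : List ℝ) (hMs : Ms.Pairwise (· > ·))
    (hpos : ∀ M ∈ Ms, 0 < M) (hA : ∀ x ∈ A, x = 0 ∨ x ∈ Ms) :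
    A.sort (· ≥ ·) =
      (Ms.map fun M => List.replicate (A.count M) M).flatten ++ List.replicate (A.count 0) 0 := by
  induction Ms generalizing A with
  | nil =>
    have : A = Multiset.replicate (A.count 0) 0 := by
      rw [Multiset.count_eq_card.2 fun x hx => ((hA x hx).resolve_right (by simp)).symm]
      exact Multiset.eq_replicate.2 ⟨rfl, fun x hx => (hA x hx).resolve_right (by simp)⟩
    apply List.Perm.eq_of_pairwise' (r := (· ≥ ·))
    · exact Multiset.pairwise_sort _ _
    · simp [List.pairwise_replicate]
    · rw [← Multiset.coe_eq_coe]
      simpa [Multiset.coe_replicate] using this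
  | cons M Ms ih =>
    rw [List.pairwise_cons] at hMs
    set B := A.filter (fun x => ¬ M = x) with hB
    have hsplit : A = Multiset.replicate (A.count M) M + B := by
      rw [← Multiset.filter_eq, hB, Multiset.filter_add_not]
    have hcount : ∀ x, x ≠ M → B.count x = A.count x := by
      intro x hx
      rw [hB, Multiset.count_filter, if_pos (Ne.symm hx)]
    have hM0 : 0 < M := hpos M (by simp)
    have hBmem : ∀ x ∈ B, x = 0 ∨ x ∈ Ms := by
      intro x hx
      rw [hB, Multiset.mem_filter] at hx
      rcases hA x hx.1 with h | h
      · exact Or.inl h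
      · exact Or.inr ((List.mem_cons.1 h).resolve_left (Ne.symm hx.2))
    have h := ih B hMs.2 (fun x hx => hpos x (by simp [hx])) hBmem
    rw [hcount 0 hM0.ne] at h
    have hmap : (Ms.map fun M => List.replicate (B.count M) M) =
        Ms.map fun M => List.replicate (A.count M) M := by
      apply List.map_congr_left
      intro x hx
      rw [hcount x (hMs.1 x hx).ne]
    rw [hmap] at h
    rw [List.map_cons, List.flatten_cons, List.append_assoc, ← h]
    conv_lhs => rw [hsplit]
    rw [sort_ge_add]
    · congr 1
      apply List.Perm.eq_of_pairwise' (r := (· ≥ ·))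
      · exact Multiset.pairwise_sort _ _
      · simp [List.pairwise_replicate]
      · rw [← Multiset.coe_eq_coe]
        simp [Multiset.coe_replicate]
    · intro x hx y hy
      rw [Multiset.eq_of_mem_replicate hx]
      rcases hBmem y hy with rfl | h
      · exact hM0.le
      · exact (hMs.1 y h).le

theorem Records.exists_gradation_eq [Fintype V] {G : SimpleGraph V} {f : V → ℝ}
    {l : List (Option ℝ)} {σ : State V} {Ms : List ℝ} {z' : ℕ} (hr : Records G f l σ Ms z')
    (hσ : σ.graph = ⊥) :
    ∃ (r : ℕ) (M : Fin r → ℝ) (k : Fin r → ℕ) (z z' : ℕ),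
      StrictAnti M ∧ (∀ i, 0 < M i ∧ 0 < k i) ∧
      l.reduceOption = List.ofFn M ++ List.replicate z' 0 ∧
      gradation G f =
        (List.ofFn fun i => List.replicate (k i) (M i)).flatten ++ List.replicate z 0 := by
  classical
  set A := G.edgeFinset.val.map (edgeTone f) with hA
  have hmem : ∀ x, x ∈ A ↔ ∃ e ∈ G.edgeSet, edgeTone f e = x := by
    intro x; simp [hA]
  refine ⟨Ms.length, fun i => Ms.get i, fun i => A.count (Ms.get i), A.count 0, z', ?_, ?_, ?_, ?_⟩
  · intro i j hij
    exact List.pairwise_iff_get.1 hr.decreasing i j hij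
  · intro i
    have := List.get_mem Ms i
    exact ⟨hr.pos _ this, Multiset.count_pos.2 ((hmem _).2 (hr.attained _ this))⟩
  · rw [hr.labels, List.ofFn_get]
  · have h := sort_eq_flatten A Ms hr.decreasing hr.pos fun x hx => by
      obtain ⟨e, he, rfl⟩ := (hmem x).1 hx
      exact hr.deleted e he (by simp [hσ])
    have h2 : (List.ofFn fun i => List.replicate (A.count (Ms.get i)) (Ms.get i)) =
        Ms.map fun M => List.replicate (A.count M) M := by
      conv_rhs => rw [← List.ofFn_get Ms, List.map_ofFn]
      rfl
    rw [h2, ← h, hA]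
    unfold gradation
    congr!

theorem State.Sound.tone_eq_of_edgeless {σ : State V} {f : V → ℝ} (hσ : σ.Sound f)
    (h : σ.graph = ⊥) : σ.tone = f := by
  funext v
  obtain ⟨u, hu, ⟨p⟩⟩ := hσ.reach v
  rw [h] at p
  cases p with
  | nil => exact hσ.tone_eq v hu
  | cons hadj _ => exact absurd hadj (by simp)

end Procedure

/-! ### Capped distances and rounds of colouring -/

section Rounds

variable {V : Type*}

/-- The edges of `G` that do not join two vertices of `C`. -/
def openGraph (G : SimpleGraph V) (C : Set V) : SimpleGraph V where
  Adj u v := G.Adj u v ∧ ¬ (u ∈ C ∧ v ∈ C)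
  symm := ⟨fun _ _ h => ⟨h.1.symm, fun h' => h.2 h'.symm⟩⟩
  loopless := ⟨fun _ h => h.1.ne rfl⟩

/-- `D` is the distance of `H`, with the value `n` for vertices in different components. -/
structure IsCappedDist (H : SimpleGraph V) (n : ℕ) (D : V → V → ℕ) : Prop where
  lt_iff : ∀ u v, D u v < n ↔ H.Reachable u v
  eq_dist : ∀ u v, H.Reachable u v → D u v = H.dist u v

/-- The state of the Floyd–Warshall algorithm after the pivots in `K`. -/
structure IsPartialDist (H : SimpleGraph V) (n : ℕ) (K : Set V) (D : V → V → ℕ) : Prop where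
  self : ∀ u, D u u = 0
  adj : ∀ u v, H.Adj u v → D u v ≤ 1
  le : ∀ u v, D u v ≤ n
  sound : ∀ u v, D u v < n → ∃ p : H.Walk u v, p.length = D u v
  triangle : ∀ x ∈ K, ∀ u v, D u v ≤ D u x + D x v

open Classical in
/-- The initial matrix of the Floyd–Warshall algorithm. -/
noncomputable def adjDist (H : SimpleGraph V) (n : ℕ) (u v : V) : ℕ :=
  if u = v then 0 else if H.Adj u v then 1 else n

theorem isPartialDist_adjDist (H : SimpleGraph V) {n : ℕ} (hn : 0 < n) :
    IsPartialDist H n ∅ (adjDist H n) := by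
  refine ⟨fun u => by simp [adjDist], fun u v h => by simp [adjDist, h, h.ne], fun u v => ?_,
    fun u v h => ?_, by simp⟩
  · unfold adjDist; split_ifs <;> omega
  · unfold adjDist at h ⊢
    split_ifs at h ⊢ with h1 h2
    · subst h1; exact ⟨.nil, rfl⟩
    · exact ⟨.cons h2 .nil, rfl⟩
    · omega

/-- One pivot of the Floyd–Warshall algorithm. -/
def pivot (D : V → V → ℕ) (x u v : V) : ℕ := min (D u v) (D u x + D x v)

/-- Instead of minimality over walks with inner vertices in `K`, the invariant keeps the triangle
inequality through the vertices of `K`; a pivot preserves it by the old inequalities alone. -/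
theorem IsPartialDist.pivot {H : SimpleGraph V} {n : ℕ} {K : Set V} {D : V → V → ℕ}
    (h : IsPartialDist H n K D) (x : V) : IsPartialDist H n (insert x K) (pivot D x) := by
  refine ⟨fun u => by simp [Gradation.pivot, h.self], fun u v huv => (min_le_left _ _).trans
    (h.adj u v huv), fun u v => (min_le_left _ _).trans (h.le u v), fun u v huv => ?_, ?_⟩
  · unfold Gradation.pivot at huv ⊢
    rcases le_total (D u v) (D u x + D x v) with hle | hle
    · rw [min_eq_left hle] at huv ⊢
      exact h.sound u v huv
    · rw [min_eq_right hle] at huv ⊢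
      obtain ⟨p, hp⟩ := h.sound u x (by omega)
      obtain ⟨q, hq⟩ := h.sound x v (by omega)
      exact ⟨p.append q, by rw [SimpleGraph.Walk.length_append, hp, hq]⟩
  · rintro y hy u v
    unfold Gradation.pivot
    rcases hy with rfl | hy
    · have := h.self y
      omega
    · have h1 := h.triangle y hy u v
      have h2 := h.triangle y hy u x
      have h3 := h.triangle y hy x v
      omega

/-- With all triangle inequalities, `D` is at most the length of any walk; `sound` gives the
converse. A shortest path has fewer edges than there are vertices, so the cap is never mistaken for
a distance. -/
theorem IsPartialDist.isCappedDist [Fintype V] {H : SimpleGraph V} {D : V → V → ℕ}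
    (h : IsPartialDist H (Fintype.card V) Set.univ D) : IsCappedDist H (Fintype.card V) D := by
  have hle : ∀ u v, ∀ p : H.Walk u v, D u v ≤ p.length := by
    intro u v p
    induction p with
    | nil => simp [h.self]
    | @cons a b c hadj p ih =>
      have h1 := h.triangle b (Set.mem_univ b) a c
      have h2 := h.adj a b hadj
      rw [SimpleGraph.Walk.length_cons]
      omega
  have key : ∀ u v, H.Reachable u v → D u v = H.dist u v ∧ D u v < Fintype.card V := by
    intro u v huv
    obtain ⟨p, hp, hpd⟩ := huv.exists_path_of_dist
    have h1 := hle u v p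
    have h2 := hp.length_lt
    obtain ⟨q, hq⟩ := h.sound u v (by omega)
    have h3 := SimpleGraph.dist_le q
    omega
  refine ⟨fun u v => ⟨fun huv => ?_, fun huv => (key u v huv).2⟩, fun u v huv => (key u v huv).1⟩
  obtain ⟨p, -⟩ := h.sound u v huv
  exact ⟨p⟩

theorem IsBalanced.openGraph {G : SimpleGraph V} {S C : Set V} {f : V → ℝ} (hf : IsBalanced G S f)
    (hSC : S ⊆ C) : IsBalanced (openGraph G C) C f := by
  intro v hv x hx
  obtain ⟨⟨y, hy, h1⟩, ⟨z, hz, h2⟩⟩ := hf v (fun h => hv (hSC h)) x hx.1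
  exact ⟨⟨y, ⟨hy, fun h => hv h.1⟩, h1⟩, ⟨z, ⟨hz, fun h => hv h.1⟩, h2⟩⟩

/-- `f` is constant along the edges that do not join two vertices of `C`. -/
def IsFlat (G : SimpleGraph V) (C : Set V) (f : V → ℝ) : Prop :=
  ∀ a b, (openGraph G C).Adj a b → |f a - f b| ≤ 0

theorem IsFlat.mono {G : SimpleGraph V} {C C' : Set V} {f : V → ℝ} (h : IsFlat G C f)
    (hC : C ⊆ C') : IsFlat G C' f :=
  fun a b hab => h a b ⟨hab.1, fun h' => hab.2 ⟨hC h'.1, hC h'.2⟩⟩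

/-- `D` tells which vertices have the same value as `w`. -/
def Determines (n : ℕ) (C : Set V) (f : V → ℝ) (D : V → V → ℕ) : Prop :=
  ∀ w, (∃ c ∈ C, D w c < n) ∧ ∀ c, D w c < n → f c = f w

/-- A walk to `C`, cut at its first vertex there, stays in the open graph, along which `f` is
constant. -/
theorem IsFlat.determines {G : SimpleGraph V} (hG : G.Connected) {C C' : Set V} {f : V → ℝ} {n : ℕ}
    {D : V → V → ℕ} (h : IsFlat G C f) (hD : IsCappedDist (openGraph G C) n D) (hne : C.Nonempty)
    (hC : C ⊆ C') : Determines n C' f D := by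
  intro w
  constructor
  · obtain ⟨u, hu⟩ := hne
    obtain ⟨p⟩ := hG.preconnected w u
    obtain ⟨c, hc, hr⟩ := reachable_first (H' := Gradation.openGraph G C) (C := C)
      (fun a b hab hn => ⟨hab, hn⟩) p hu
    exact ⟨c, hC hc, (hD.lt_iff w c).2 hr⟩
  · intro c hc
    have := sub_le_mul_dist h ((hD.lt_iff w c).1 hc)
    rw [zero_mul] at this
    linarith [abs_le.1 this]

/-- The slope `b` of the pair `u`, `v` is maximum among all pairs of vertices of `C`. -/
structure IsSteepest (n : ℕ) (C : Set V) (f : V → ℝ) (D : V → V → ℕ) (u v : V) (b : ℝ) : Prop where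
  left : u ∈ C
  right : v ∈ C
  lt : D u v < n
  eq : b = (f v - f u) / D u v
  max : ∀ u' ∈ C, ∀ v' ∈ C, D u' v' < n → (f v' - f u') / D u' v' ≤ b

/-- The diagonal pair takes part, with slope `0 / 0 = 0`. -/
theorem IsSteepest.nonneg {n : ℕ} {C : Set V} {f : V → ℝ} {D : V → V → ℕ} {u v : V} {b : ℝ}
    (h : IsSteepest n C f D u v b) {H : SimpleGraph V} (hD : IsCappedDist H n D) : 0 ≤ b := by
  have := h.max u h.left u h.left ((hD.lt_iff u u).2 (.refl _))
  simpa using this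

theorem IsSteepest.lipschitz [Finite V] {G : SimpleGraph V} {C : Set V} {f : V → ℝ} {n : ℕ}
    {D : V → V → ℕ} {u v : V} {b : ℝ} (h : IsSteepest n C f D u v b)
    (hf : IsBalanced (openGraph G C) C f) (hD : IsCappedDist (openGraph G C) n D) :
    ∀ x y, (openGraph G C).Adj x y → |f x - f y| ≤ b := by
  intro x y hxy
  refine hf.lipschitz (h.nonneg hD) ?_ hxy
  intro u' hu' v' hv' hr
  have h1 := h.max u' hu' v' hv' ((hD.lt_iff _ _).2 hr)
  rw [hD.eq_dist _ _ hr] at h1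
  by_cases hne : u' = v'
  · subst hne; simp
  · exact (div_le_iff₀ (by exact_mod_cast hr.pos_dist_of_ne hne)).1 h1

theorem IsSteepest.eq_of_mem [Finite V] {G : SimpleGraph V} {C : Set V} {f : V → ℝ} {n : ℕ}
    {D : V → V → ℕ} {u v : V} {b : ℝ} (h : IsSteepest n C f D u v b)
    (hf : IsBalanced (openGraph G C) C f) (hD : IsCappedDist (openGraph G C) n D) {w : V}
    (hw : D u w + D w v ≤ D u v) : f u + D u w * b = f w := by
  have hlt := h.lt
  have r := (hD.lt_iff u v).1 hlt
  have r1 := (hD.lt_iff u w).1 (by omega)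
  have r2 := (hD.lt_iff w v).1 (by omega)
  have hL := h.lipschitz hf hD
  rw [hD.eq_dist _ _ r1, hD.eq_dist _ _ r2, hD.eq_dist _ _ r] at hw
  have hmem : w ∈ geodesicVertices (Gradation.openGraph G C) u v :=
    mem_geodesicVertices.2 ⟨r1, r2, le_antisymm hw (r1.dist_triangle_left v)⟩
  rw [hD.eq_dist _ _ r1]
  refine (eq_on_geodesicVertices hL hmem ?_).symm
  by_cases hne : u = v
  · subst hne; simp
  · have hd : (0 : ℝ) < (Gradation.openGraph G C).dist u v := by
      exact_mod_cast r.pos_dist_of_ne hne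
    rw [h.eq, hD.eq_dist _ _ r, div_mul_cancel₀ _ hd.ne']

/-- A diagonal pair has slope 0, which is then a Lipschitz constant. Otherwise the vertex after `u`
on a geodesic is uncoloured, because no open edge joins two vertices of `C`. -/
theorem IsSteepest.isFlat_or_exists [Finite V] {G : SimpleGraph V} {C : Set V} {f : V → ℝ} {n : ℕ}
    {D : V → V → ℕ} {u v : V} {b : ℝ} (h : IsSteepest n C f D u v b)
    (hf : IsBalanced (openGraph G C) C f) (hD : IsCappedDist (openGraph G C) n D) :
    IsFlat G C f ∨ ∃ w, w ∉ C ∧ D u w + D w v ≤ D u v := by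
  have r := (hD.lt_iff u v).1 h.lt
  by_cases hne : u = v
  · left
    have hb : b = 0 := by rw [h.eq, hne]; simp
    intro x y hxy
    rw [← hb]
    exact h.lipschitz hf hD x y hxy
  · right
    obtain ⟨w, hadj, hw⟩ := exists_adj_mem_geodesicVertices r hne
    obtain ⟨r1, r2, hw⟩ := mem_geodesicVertices.1 hw
    exact ⟨w, fun hC => hadj.2 ⟨h.left, hC⟩, by
      rw [hD.eq_dist _ _ r1, hD.eq_dist _ _ r2, hD.eq_dist _ _ r, hw]⟩

end Rounds

/-! ### A calculus for programs with counting loops -/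

section Calculus

/-- A bound for the number of steps of a program whose loops have at most `n` iterations. -/
def cost (n : ℕ) : Prog → ℕ
  | .skip => 1
  | .instr _ => 1
  | .seq p q => cost n p + cost n q
  | .ite _ p q => 1 + (cost n p + cost n q)
  | .loop _ p => 1 + n * (1 + cost n p)

/-- A sufficient condition for `p`, started with memory `m`, to end with a memory that satisfies `Q`,
each of its loops having exactly `n` iterations. -/
def wp (n : ℕ) : Prog → (Store → Prop) → Store → Prop
  | .skip, Q, m => Q m
  | .instr i, Q, m => Q (i.exec m)
  | .seq p q, Q, m => wp n p (wp n q Q) m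
  | .ite b p q, Q, m => (b.Holds m → wp n p Q m) ∧ (¬ b.Holds m → wp n q Q m)
  | .loop b p, Q, m => ∃ I : ℕ → Store → Prop, I 0 m ∧
      (∀ i < n, ∀ m, I i m → b.Holds m ∧ wp n p (I (i + 1)) m) ∧
      (∀ m, I n m → ¬ b.Holds m ∧ Q m)

theorem wp_mono {n : ℕ} {p : Prog} {Q Q' : Store → Prop} (h : ∀ m, Q m → Q' m) {m : Store}
    (hp : wp n p Q m) : wp n p Q' m := by
  induction p generalizing Q Q' m with
  | skip => exact h m hp
  | instr i => exact h _ hp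
  | seq p q ihp ihq => exact ihp (fun m hm => ihq h hm) hp
  | ite b p q ihp ihq => exact ⟨fun hb => ihp h (hp.1 hb), fun hb => ihq h (hp.2 hb)⟩
  | loop b p ih =>
    obtain ⟨I, h0, h1, h2⟩ := hp
    exact ⟨I, h0, h1, fun m hm => ⟨(h2 m hm).1, h m (h2 m hm).2⟩⟩

theorem wp_seq {n : ℕ} {p q : Prog} (R : Store → Prop) {Q : Store → Prop} {m : Store}
    (hp : wp n p R m) (hq : ∀ m', R m' → wp n q Q m') : wp n (.seq p q) Q m :=
  wp_mono hq hp

theorem exists_runs_of_wp {n : ℕ} {p : Prog} {Q : Store → Prop} {m : Store} (h : wp n p Q m) :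
    ∃ t m', Runs p m t m' ∧ t ≤ cost n p ∧ Q m' := by
  induction p generalizing Q m with
  | skip => exact ⟨1, m, .skip m, le_rfl, h⟩
  | instr i => exact ⟨1, _, .instr i m, le_rfl, h⟩
  | seq p q ihp ihq =>
    obtain ⟨t, m', hr, ht, h'⟩ := ihp h
    obtain ⟨t', m'', hr', ht', h''⟩ := ihq h'
    exact ⟨_, m'', .seq p q m m' m'' t t' hr hr', add_le_add ht ht', h''⟩
  | ite b p q ihp ihq =>
    by_cases hb : b.Holds m
    · obtain ⟨t, m', hr, ht, h'⟩ := ihp (h.1 hb)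
      exact ⟨_, m', .ite_true b p q m m' t hb hr, by simp only [cost]; omega, h'⟩
    · obtain ⟨t, m', hr, ht, h'⟩ := ihq (h.2 hb)
      exact ⟨_, m', .ite_false b p q m m' t hb hr, by simp only [cost]; omega, h'⟩
  | loop b p ih =>
    obtain ⟨I, h0, h1, h2⟩ := h
    have key : ∀ j i, i + j = n → ∀ m, I i m →
        ∃ t m', Runs (.loop b p) m t m' ∧ t ≤ 1 + j * (1 + cost n p) ∧ Q m' := by
      intro j
      induction j with
      | zero =>
        rintro i hi m hm
        obtain rfl : i = n := by omega
        exact ⟨1, m, Runs.loop_stop b p m (h2 m hm).1, by simp, (h2 m hm).2⟩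
      | succ j ihj =>
        rintro i hi m hm
        obtain ⟨hb, hp⟩ := h1 i (by omega) m hm
        obtain ⟨t, m', hr, ht, h'⟩ := ih hp
        obtain ⟨t', m'', hr', ht', h''⟩ := ihj (i + 1) (by omega) m' h'
        refine ⟨_, m'', .loop_continue b p m m' m'' t t' hb hr hr', ?_, h''⟩
        rw [Nat.succ_mul]
        omega
    exact key n 0 (by omega) m h0

/-- Change one register. -/
def Store.setIreg (m : Store) (x k : ℕ) : Store := { m with ireg := Function.update m.ireg x k }

/-- `for x < register 0 do body`, provided that register `1` holds `1`. -/
def forLoop (x : ℕ) (body : Prog) : Prog :=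
  .seq (.instr (.iconst x 0)) (.loop (.ilt x 0) (.seq body (.instr (.iadd x x 1))))

/-- The invariant must not depend on the counter register, since the loop itself resets and
increments it. -/
theorem wp_forLoop {n x : ℕ} {body : Prog} (I : ℕ → Store → Prop)
    {Q : Store → Prop} {m : Store} (hI : ∀ i m k, I i m → I i (m.setIreg x k))
    (hreg : ∀ i m, I i m → m.ireg 0 = n ∧ m.ireg 1 = 1) (h0 : I 0 m)
    (hs : ∀ i < n, ∀ m, I i m → m.ireg x = i →
      wp n body (fun m' => m'.ireg x = i ∧ I (i + 1) m') m)
    (hQ : ∀ m, I n m → Q m) : wp n (forLoop x body) Q m := by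
  refine ⟨fun i m => I i m ∧ m.ireg x = i, ⟨hI 0 m 0 h0, by simp [Instr.exec]⟩, ?_, ?_⟩
  · rintro i hi m ⟨hm, hmx⟩
    refine ⟨by simp only [Test.Holds, hmx, (hreg i m hm).1, hi], ?_⟩
    change wp n body (wp n (.instr (.iadd x x 1)) _) m
    refine wp_mono ?_ (hs i hi m hm hmx)
    rintro m' ⟨h1, h2⟩
    have h3 := hI (i + 1) m' (m'.ireg x + m'.ireg 1) h2
    exact ⟨h3, by simp [Instr.exec, h1, (hreg _ _ h2).2]⟩
  · rintro m ⟨hm, hmx⟩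
    exact ⟨by simp only [Test.Holds, hmx, (hreg n m hm).1, lt_irrefl, not_false_eq_true], hQ m hm⟩

variable {V : Type*} {n : ℕ} (e : V ≃ Fin n)

/-- The rule for a loop over all vertices. -/
theorem wp_forVertex {x : ℕ} {body : Prog} (I : Set V → Store → Prop)
    {Q : Store → Prop} {m : Store} (hI : ∀ S m k, I S m → I S (m.setIreg x k))
    (hreg : ∀ S m, I S m → m.ireg 0 = n ∧ m.ireg 1 = 1) (h0 : I ∅ m)
    (hs : ∀ S v, v ∉ S → ∀ m, I S m → m.ireg x = e v →
      wp n body (fun m' => m'.ireg x = e v ∧ I (insert v S) m') m)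
    (hQ : ∀ m, I Set.univ m → Q m) : wp n (forLoop x body) Q m := by
  refine wp_forLoop (fun i => I {v | (e v : ℕ) < i}) (fun i => hI _) (fun i => hreg _)
    (by simpa using h0) ?_ ?_
  · intro i hi m hm hmx
    have h := hs _ (e.symm ⟨i, hi⟩) (by simp) m hm (by simpa using hmx)
    have hset : ({v | (e v : ℕ) < i + 1} : Set V) = insert (e.symm ⟨i, hi⟩) {v | (e v : ℕ) < i} := by
      ext v
      rw [Set.mem_insert_iff, Equiv.eq_symm_apply, Fin.ext_iff]
      change (e v : ℕ) < i + 1 ↔ (e v : ℕ) = i ∨ (e v : ℕ) < i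
      omega
    rw [hset]
    simpa using h
  · intro m hm
    refine hQ m ?_
    have hset : ({v | (e v : ℕ) < n} : Set V) = Set.univ :=
      Set.eq_univ_of_forall fun v => (e v).2
    rwa [hset] at hm

/-- The rule for a loop over all pairs of vertices. -/
theorem wp_forPair {x y : ℕ} (hxy : x ≠ y)
    {body : Prog} (I : Set (V × V) → Store → Prop) {Q : Store → Prop} {m : Store}
    (hI : ∀ S m k, I S m → I S (m.setIreg x k)) (hI' : ∀ S m k, I S m → I S (m.setIreg y k))
    (hreg : ∀ S m, I S m → m.ireg 0 = n ∧ m.ireg 1 = 1) (h0 : I ∅ m)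
    (hs : ∀ S u v, (u, v) ∉ S → ∀ m, I S m → m.ireg x = e u → m.ireg y = e v →
      wp n body (fun m' => m'.ireg x = e u ∧ m'.ireg y = e v ∧ I (insert (u, v) S) m') m)
    (hQ : ∀ m, I Set.univ m → Q m) : wp n (forLoop x (forLoop y body)) Q m := by
  refine wp_forVertex e (fun S => I {p | p.1 ∈ S}) (fun S => hI _) (fun S => hreg _)
    (by simpa using h0) ?_ (by simpa using hQ)
  intro S u hu m hm hmx
  refine wp_forVertex e
    (fun T m => m.ireg x = e u ∧ I ({p | p.1 ∈ S} ∪ {p | p.1 = u ∧ p.2 ∈ T}) m)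
    (fun T m k h => ⟨by simpa [Store.setIreg, hxy] using h.1, hI' _ _ _ h.2⟩)
    (fun T m h => hreg _ _ h.2) ⟨hmx, by simpa using hm⟩ ?_ ?_
  · rintro T v hv m ⟨h1, h2⟩ h3
    refine wp_mono ?_ (hs _ u v (by simp [hu, hv]) m h2 h1 h3)
    rintro m' ⟨k1, k2, k3⟩
    refine ⟨k2, k1, ?_⟩
    convert k3 using 1
    ext ⟨a, b⟩
    simp
    tauto
  · rintro m ⟨h1, h2⟩
    refine ⟨h1, ?_⟩
    convert h2 using 1
    ext ⟨a, b⟩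
    simp
    tauto

/-- A sequence of instructions. -/
def code : List Instr → Prog
  | [] => .skip
  | i :: l => .seq (.instr i) (code l)

end Calculus

/-! ### The program -/

section Program

/-- Integer matrix `2` becomes the initial matrix of the Floyd–Warshall algorithm. -/
def initDist : Prog :=
  forLoop 4 (forLoop 5
    (.seq (code [.iload 7 0 4 5, .iload 8 1 2 4, .iload 9 1 2 5, .iadd 8 8 9, .iadd 9 0 2])
    (.seq (.ite (.ilt 1 8) .skip (.ite (.ilt 2 7) (.instr (.iadd 9 1 2)) .skip))
    (.seq (.ite (.ilt 4 5) .skip (.ite (.ilt 5 4) .skip (.instr (.iadd 9 2 2))))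
      (.instr (.istore 2 4 5 9))))))

/-- The Floyd–Warshall algorithm on integer matrix `2`. -/
def allDist : Prog :=
  forLoop 4 (forLoop 5 (forLoop 6
    (.seq (code [.iload 7 2 5 4, .iload 8 2 4 6, .iadd 7 7 8, .iload 8 2 5 6])
      (.ite (.ilt 7 8) (.instr (.istore 2 5 6 7)) .skip))))

/-- Registers `10` and `11` become a steepest pair, real register `0` its slope. -/
def steepest : Prog :=
  .seq (code [.rcast 0 2, .rcast 1 1, .rsub 0 0 1])
    (forLoop 4 (forLoop 5
      (.seq (code [.iload 7 1 2 4, .iload 8 1 2 5, .iadd 7 7 8, .iload 8 2 4 5])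
        (.ite (.ilt 1 7) (.ite (.ilt 8 0)
          (.seq (code [.rcast 1 8, .rload 2 1 2 4, .rload 3 1 2 5, .rsub 2 3 2, .rdiv 3 2 1])
            (.ite (.rlt 0 3) (code [.rdiv 0 2 1, .iadd 10 4 2, .iadd 11 5 2]) .skip))
          .skip) .skip))))

/-- The geodesics of the steepest pair are coloured. -/
def colour : Prog :=
  .seq (code [.rload 1 1 2 10, .iload 9 2 10 11])
    (forLoop 4 (.seq (code [.iload 7 2 10 4, .iload 8 2 4 11, .iadd 8 7 8])
      (.ite (.ilt 9 8) .skip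
        (code [.rcast 2 7, .rmul 2 2 0, .radd 2 1 2, .rstore 1 2 4 2, .istore 1 2 4 1]))))

/-- Each vertex gets the value of the coloured vertices at finite distance. -/
def spread : Prog :=
  forLoop 4 (forLoop 5 (.seq (code [.iload 7 1 2 5, .iload 8 2 4 5])
    (.ite (.ilt 2 7) (.ite (.ilt 8 0) (code [.rload 1 1 2 5, .rstore 1 2 4 1]) .skip) .skip)))

/-- The constants and the given values. -/
def prepare : Prog :=
  .seq (code [.iconst 1 1, .iconst 2 0]) (forLoop 4 (code [.rload 0 0 2 4, .rstore 1 2 4 0]))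

/-- The program that computes the balanced extension. -/
def program : Prog :=
  .seq prepare
    (.seq (forLoop 3 (.seq initDist (.seq allDist (.seq steepest colour)))) spread)

/-- The fourth power stems from the triple loop of `allDist` inside the loop over rounds.
Substituting `k + 1` makes it a comparison of polynomials in `k`. -/
theorem cost_program_le {n : ℕ} (hn : 0 < n) : cost n program ≤ 1000 * n ^ 4 := by
  obtain ⟨k, rfl⟩ : ∃ k, n = k + 1 := ⟨n - 1, by omega⟩
  simp only [program, prepare, initDist, allDist, steepest, colour, spread, forLoop, code, cost]
  ring_nf
  nlinarith [Nat.zero_le k, Nat.zero_le (k ^ 2), Nat.zero_le (k ^ 3), Nat.zero_le (k ^ 4)]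

/-! ### The memory invariant -/

variable {V : Type*} {n : ℕ} (e : V ≃ Fin n) (G : SimpleGraph V) (f : V → ℝ)

/-- The memory in the `i`-th round, when the vertices of `C` are coloured. -/
structure Memory (i : ℕ) (C : Set V) (m : Store) : Prop where
  size : m.ireg 0 = n
  one : m.ireg 1 = 1
  zero : m.ireg 2 = 0
  round : m.ireg 3 = i
  adj : ∀ u v, G.Adj u v → m.imat 0 (e u) (e v) = 1
  not_adj : ∀ u v, ¬ G.Adj u v → m.imat 0 (e u) (e v) = 0
  coloured : ∀ v ∈ C, m.imat 1 0 (e v) = 1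
  not_coloured : ∀ v, v ∉ C → m.imat 1 0 (e v) = 0
  tone : ∀ v ∈ C, m.rmat 1 0 (e v) = f v

variable {e G f} {i : ℕ} {C : Set V} {m m' : Store}

theorem Memory.congr (h : Memory e G f i C m) (h0 : m'.ireg 0 = m.ireg 0) (h1 : m'.ireg 1 = m.ireg 1)
    (h2 : m'.ireg 2 = m.ireg 2) (h3 : m'.ireg 3 = m.ireg 3) (k0 : m'.imat 0 = m.imat 0)
    (k1 : m'.imat 1 = m.imat 1) (l1 : m'.rmat 1 = m.rmat 1) : Memory e G f i C m' := by
  constructor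
  · rw [h0, h.size]
  · rw [h1, h.one]
  · rw [h2, h.zero]
  · rw [h3, h.round]
  · rw [k0]; exact h.adj
  · rw [k0]; exact h.not_adj
  · rw [k1]; exact h.coloured
  · rw [k1]; exact h.not_coloured
  · rw [l1]; exact h.tone

theorem setEntry_of_ne {α : Type} (M : ℕ → ℕ → ℕ → α) {a b : ℕ} (h : b ≠ a) (i j : ℕ) (x : α) :
    setEntry M a i j x b = M b := by
  funext i' j'
  simp [setEntry, h]

open Classical in
theorem setEntry_vertex {α : Type} (M : ℕ → ℕ → ℕ → α) (a : ℕ) (u v u' v' : V) (x : α) :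
    setEntry M a (e u) (e v) x a (e u') (e v') =
      if u' = u ∧ v' = v then x else M a (e u') (e v') :=
  if_congr (by simp [Fin.val_inj]) rfl rfl

open Classical in
theorem setEntry_vertex_zero {α : Type} (M : ℕ → ℕ → ℕ → α) (a : ℕ) (v v' : V) (x : α) :
    setEntry M a 0 (e v) x a 0 (e v') = if v' = v then x else M a 0 (e v') :=
  if_congr (by simp [Fin.val_inj]) rfl rfl

theorem Memory.setIreg (h : Memory e G f i C m) {x : ℕ} (hx : 3 < x) (k : ℕ) :
    Memory e G f i C (m.setIreg x k) := by
  refine h.congr ?_ ?_ ?_ ?_ rfl rfl rfl <;>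
    exact Function.update_of_ne (by omega) _ _

/-- `m'` differs from `m` only in the registers for temporary values. -/
structure Agree (m m' : Store) : Prop where
  ireg : ∀ x < 7, m'.ireg x = m.ireg x
  imat : m'.imat = m.imat
  rmat : m'.rmat = m.rmat

theorem Memory.agree (h : Memory e G f i C m) (h' : Agree m m') : Memory e G f i C m' :=
  h.congr (h'.ireg 0 (by decide)) (h'.ireg 1 (by decide)) (h'.ireg 2 (by decide))
    (h'.ireg 3 (by decide)) (by rw [h'.imat]) (by rw [h'.imat]) (by rw [h'.rmat])

theorem Memory.setDist (h : Memory e G f i C m) (a b x : ℕ) :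
    Memory e G f i C { m with imat := setEntry m.imat 2 a b x } :=
  h.congr rfl rfl rfl rfl (setEntry_of_ne _ (by decide : (0 : ℕ) ≠ 2) a b x)
    (setEntry_of_ne _ (by decide : (1 : ℕ) ≠ 2) a b x) rfl

theorem Agree.refl (m : Store) : Agree m m := ⟨fun _ _ => rfl, rfl, rfl⟩

theorem Agree.trans {m'' : Store} (h : Agree m m') (h' : Agree m' m'') : Agree m m'' :=
  ⟨fun x hx => (h'.ireg x hx).trans (h.ireg x hx), h'.imat.trans h.imat, h'.rmat.trans h.rmat⟩

theorem Agree.setIreg (h : Agree m m') {x : ℕ} (hx : 7 ≤ x) (k : ℕ) : Agree m (m'.setIreg x k) :=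
  ⟨fun y hy => (Function.update_of_ne (by omega) _ _).trans (h.ireg y hy), h.imat, h.rmat⟩

theorem Agree.setRreg (h : Agree m m') (x : ℕ) (k : ℝ) :
    Agree m { m' with rreg := Function.update m'.rreg x k } :=
  ⟨h.ireg, h.imat, h.rmat⟩

variable (e) in
/-- Integer matrix `2` holds `D`. -/
def HoldsDist (D : V → V → ℕ) (m : Store) : Prop := ∀ u v, m.imat 2 (e u) (e v) = D u v

open Classical in
theorem Memory.adj_eq (h : Memory e G f i C m) (u v : V) :
    m.imat 0 (e u) (e v) = if G.Adj u v then 1 else 0 := by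
  split_ifs with h'
  · exact h.adj u v h'
  · exact h.not_adj u v h'

open Classical in
theorem Memory.coloured_eq (h : Memory e G f i C m) (v : V) :
    m.imat 1 0 (e v) = if v ∈ C then 1 else 0 := by
  split_ifs with h'
  · exact h.coloured v h'
  · exact h.not_coloured v h'

theorem wp_initDist (h : Memory e G f i C m) :
    wp n initDist (fun m' => Memory e G f i C m' ∧ HoldsDist e (adjDist (openGraph G C) n) m') m := by
  classical
  refine wp_forPair e (by decide) (fun S m => Memory e G f i C m ∧
    ∀ u v, (u, v) ∈ S → m.imat 2 (e u) (e v) = adjDist (openGraph G C) n u v)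
    (fun S m k h => ⟨h.1.setIreg (by decide) k, h.2⟩)
    (fun S m k h => ⟨h.1.setIreg (by decide) k, h.2⟩) (fun S m h => ⟨h.1.size, h.1.one⟩)
    ⟨h, by simp⟩ ?_ (fun m h => ⟨h.1, fun u v => h.2 u v trivial⟩)
  rintro S u v - m ⟨hm, hS⟩ hu hv
  -- Register `8` counts the coloured ends, so a value above 1 closes the edge; register `9` starts
  -- with `n`, the code for infinity.
  refine wp_seq (fun m' => Agree m m' ∧ m'.ireg 7 = (if G.Adj u v then 1 else 0) ∧
    m'.ireg 8 = (if u ∈ C then 1 else 0) + (if v ∈ C then 1 else 0) ∧ m'.ireg 9 = n)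
    ⟨⟨fun x hx => by interval_cases x <;> rfl, rfl, rfl⟩,
      by simp [Instr.exec, hu, hv, hm.adj_eq],
      by simp [Instr.exec, hm.zero, hu, hv, hm.coloured_eq],
      by simp [Instr.exec, hm.size, hm.zero]⟩ ?_
  rintro m1 ⟨ha, h7, h8, h9⟩
  have hm1 := hm.agree ha
  refine wp_seq (fun m' => Agree m m' ∧ m'.ireg 9 = if (openGraph G C).Adj u v then 1 else n)
    ⟨fun hb => ⟨ha, ?_⟩, fun hb => ⟨fun hb' => ⟨ha.setIreg (by decide) _, ?_⟩,
      fun hb' => ⟨ha, ?_⟩⟩⟩ ?_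
  · simp only [Test.Holds, h8, hm1.one] at hb
    rw [h9, if_neg]
    rintro ⟨-, h⟩
    apply h
    split_ifs at hb <;> first | omega | exact ⟨by assumption, by assumption⟩
  · simp only [Test.Holds, h7, h8, hm1.one, hm1.zero] at hb hb'
    rw [if_pos]
    · simp [Instr.exec, hm1.one, hm1.zero]
    · refine ⟨by by_contra h; simp [h] at hb', fun h => hb ?_⟩
      simp [h.1, h.2]
  · simp only [Test.Holds, h7, hm1.zero] at hb'
    rw [h9, if_neg]
    intro h
    simp [h.1] at hb'
  rintro m2 ⟨ha, h9⟩
  have hm2 := hm.agree ha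
  have hu2 : m2.ireg 4 = e u := (ha.ireg 4 (by decide)).trans hu
  have hv2 : m2.ireg 5 = e v := (ha.ireg 5 (by decide)).trans hv
  have hne : u ≠ v ↔ (e u : ℕ) < e v ∨ (e v : ℕ) < e u := by
    rw [← Nat.ne_iff_lt_or_gt, Ne, Ne, Fin.val_inj, e.injective.eq_iff]
  refine wp_seq (fun m' => Agree m m' ∧ m'.ireg 9 = adjDist (openGraph G C) n u v)
    ⟨fun hb => ⟨ha, ?_⟩, fun hb => ⟨fun hb' => ⟨ha, ?_⟩,
      fun hb' => ⟨ha.setIreg (by decide) _, ?_⟩⟩⟩ ?_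
  · simp only [Test.Holds, hu2, hv2] at hb
    rw [h9, adjDist, if_neg (hne.2 (Or.inl hb))]
  · simp only [Test.Holds, hu2, hv2] at hb'
    rw [h9, adjDist, if_neg (hne.2 (Or.inr hb'))]
  · simp only [Test.Holds, hu2, hv2] at hb hb'
    have : u = v := by
      by_contra h
      exact (hne.1 h).elim hb hb'
    simp [Instr.exec, adjDist, this, hm2.zero]
  rintro m3 ⟨ha, h9⟩
  have hm3 := hm.agree ha
  have hu3 : m3.ireg 4 = e u := (ha.ireg 4 (by decide)).trans hu
  have hv3 : m3.ireg 5 = e v := (ha.ireg 5 (by decide)).trans hv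
  refine ⟨hu3, hv3, hm3.setDist _ _ _, fun u' v' h => ?_⟩
  simp only [Instr.exec, hu3, hv3, setEntry_vertex, h9, ha.imat]
  split_ifs with hc
  · rw [hc.1, hc.2]
  · exact hS u' v' (h.resolve_left fun h => hc (Prod.ext_iff.1 h))

end Program

/-! ### Verification of the subroutines and of the program -/

section Program

variable {V : Type*} {n : ℕ} {e : V ≃ Fin n} {G : SimpleGraph V} {f : V → ℝ} {i : ℕ} {C : Set V}
  {m m' : Store}

theorem HoldsDist.agree {D : V → V → ℕ} (h : HoldsDist e D m) (h' : Agree m m') :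
    HoldsDist e D m' := by
  intro u v
  rw [h'.imat]
  exact h u v

theorem wp_allDist (h : Memory e G f i C m) {H : SimpleGraph V} {D : V → V → ℕ}
    (hD : IsPartialDist H n ∅ D) (hm : HoldsDist e D m) :
    wp n allDist (fun m' => Memory e G f i C m' ∧
      ∃ D, IsPartialDist H n Set.univ D ∧ HoldsDist e D m') m := by
  refine wp_forVertex e (fun K m => Memory e G f i C m ∧
      ∃ D, IsPartialDist H n K D ∧ HoldsDist e D m)
    (fun S m k h => ⟨h.1.setIreg (by decide) k, h.2⟩) (fun S m h => ⟨h.1.size, h.1.one⟩)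
    ⟨h, D, hD, hm⟩ ?_ (fun m h => h)
  rintro K x - m ⟨hm, D, hD, hmD⟩ hx
  refine wp_forPair e (by decide) (fun S m => Memory e G f i C m ∧ m.ireg 4 = e x ∧
    ∀ u v, ((u, v) ∈ S → m.imat 2 (e u) (e v) = pivot D x u v) ∧
      ((u, v) ∉ S → m.imat 2 (e u) (e v) = D u v))
    (fun S m k h => ⟨h.1.setIreg (by decide) k, h.2⟩)
    (fun S m k h => ⟨h.1.setIreg (by decide) k, h.2⟩) (fun S m h => ⟨h.1.size, h.1.one⟩)
    ⟨hm, hx, fun u v => ⟨fun h => absurd h (by simp), fun _ => hmD u v⟩⟩ ?_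
    (fun m h => ⟨h.2.1, h.1, pivot D x, hD.pivot x, fun u v => (h.2.2 u v).1 trivial⟩)
  rintro S u v huv m ⟨hm, hx, hS⟩ hu hv
  -- Updating in place is safe: as `D x x = 0`, row and column `x` do not change during the pivot
  -- `x`.
  have hux : m.imat 2 (e u) (e x) = D u x := by
    by_cases h : (u, x) ∈ S
    · rw [(hS u x).1 h, pivot, hD.self x]; omega
    · exact (hS u x).2 h
  have hxv : m.imat 2 (e x) (e v) = D x v := by
    by_cases h : (x, v) ∈ S
    · rw [(hS x v).1 h, pivot, hD.self x]; omega
    · exact (hS x v).2 h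
  refine wp_seq (fun m' => Agree m m' ∧ m'.ireg 7 = D u x + D x v ∧ m'.ireg 8 = D u v)
    ⟨⟨fun x hx => by interval_cases x <;> rfl, rfl, rfl⟩,
      by simp [Instr.exec, hu, hv, hx, hux, hxv],
      by simp [Instr.exec, hu, hv, (hS u v).2 huv]⟩ ?_
  rintro m1 ⟨ha, h7, h8⟩
  have hm1 := hm.agree ha
  have hx1 : m1.ireg 4 = e x := (ha.ireg 4 (by decide)).trans hx
  have hu1 : m1.ireg 5 = e u := (ha.ireg 5 (by decide)).trans hu
  have hv1 : m1.ireg 6 = e v := (ha.ireg 6 (by decide)).trans hv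
  refine ⟨fun hb => ⟨hu1, hv1, hm1.setDist _ _ _, hx1, fun u' v' => ?_⟩,
    fun hb => ⟨hu1, hv1, hm1, hx1, fun u' v' => ?_⟩⟩
  · simp only [Test.Holds, h7, h8] at hb
    simp only [Instr.exec, hu1, hv1, setEntry_vertex, h7, ha.imat]
    split_ifs with hc
    · obtain ⟨rfl, rfl⟩ := hc
      refine ⟨fun _ => ?_, fun h => absurd (Set.mem_insert _ _) h⟩
      rw [pivot, min_eq_right hb.le]
    · exact ⟨fun h => (hS u' v').1 (h.resolve_left fun h => hc (Prod.ext_iff.1 h)),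
        fun h => (hS u' v').2 fun h' => h (Or.inr h')⟩
  · simp only [Test.Holds, h7, h8] at hb
    rw [ha.imat]
    refine ⟨?_, fun h => (hS u' v').2 fun h' => h (Or.inr h')⟩
    rintro (h | h)
    · obtain ⟨rfl, rfl⟩ := Prod.ext_iff.1 h
      rw [(hS u' v').2 huv, pivot, min_eq_left (not_lt.1 hb)]
    · exact (hS u' v').1 h

theorem wp_steepest (h : Memory e G f i C m) {D : V → V → ℕ} (hm : HoldsDist e D m)
    (hC : C.Nonempty) (hD : ∀ u, D u u < n) :
    wp n steepest (fun m' => Memory e G f i C m' ∧ HoldsDist e D m' ∧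
      ∃ u v, m'.ireg 10 = e u ∧ m'.ireg 11 = e v ∧ IsSteepest n C f D u v (m'.rreg 0)) m := by
  classical
  -- The start value `-1` lies below the slope 0 of the diagonal pairs, so some pair is certain to
  -- be recorded.
  refine wp_seq (fun m' => Agree m m' ∧ m'.rreg 0 = -1)
    ⟨⟨fun x hx => by interval_cases x <;> rfl, rfl, rfl⟩,
      by simp [Instr.exec, h.one, h.zero]⟩ ?_
  rintro m1 ⟨ha, h0⟩
  refine wp_forPair e (by decide) (fun S m => Memory e G f i C m ∧ HoldsDist e D m ∧
    (m.rreg 0 = -1 ∨ ∃ u v, m.ireg 10 = e u ∧ m.ireg 11 = e v ∧ u ∈ C ∧ v ∈ C ∧ D u v < n ∧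
      m.rreg 0 = (f v - f u) / D u v) ∧
    ∀ u v, (u, v) ∈ S → u ∈ C → v ∈ C → D u v < n → (f v - f u) / D u v ≤ m.rreg 0)
    (fun S m k h => ⟨h.1.setIreg (by decide) k, h.2⟩)
    (fun S m k h => ⟨h.1.setIreg (by decide) k, h.2⟩) (fun S m h => ⟨h.1.size, h.1.one⟩)
    ⟨h.agree ha, hm.agree ha, Or.inl h0, by simp⟩ ?_ ?_
  · rintro S u v - m ⟨hm, hmD, hbest, hS⟩ hu hv
    refine wp_seq (fun m' => Agree m m' ∧ m'.ireg 10 = m.ireg 10 ∧ m'.ireg 11 = m.ireg 11 ∧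
      m'.rreg 0 = m.rreg 0 ∧ m'.ireg 7 = (if u ∈ C then 1 else 0) + (if v ∈ C then 1 else 0) ∧
      m'.ireg 8 = D u v)
      ⟨⟨fun x hx => by interval_cases x <;> rfl, rfl, rfl⟩, rfl, rfl, rfl,
        by simp [Instr.exec, hm.zero, hu, hv, hm.coloured_eq],
        by simp [Instr.exec, hu, hv, hmD u v]⟩ ?_
    rintro m1 ⟨ha, h10, h11, h0, h7, h8⟩
    have hm1 := hm.agree ha
    have hu1 : m1.ireg 4 = e u := (ha.ireg 4 (by decide)).trans hu
    have hv1 : m1.ireg 5 = e v := (ha.ireg 5 (by decide)).trans hv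
    rw [← h10, ← h11, ← h0] at hbest
    rw [← h0] at hS
    -- Common to all branches that keep the recorded pair.
    have skip : ∀ m2, Agree m1 m2 → m2.ireg 10 = m1.ireg 10 → m2.ireg 11 = m1.ireg 11 →
        m2.rreg 0 = m1.rreg 0 →
        (u ∈ C → v ∈ C → D u v < n → (f v - f u) / D u v ≤ m1.rreg 0) →
        m2.ireg 4 = e u ∧ m2.ireg 5 = e v ∧ Memory e G f i C m2 ∧ HoldsDist e D m2 ∧
        (m2.rreg 0 = -1 ∨ ∃ u v, m2.ireg 10 = e u ∧ m2.ireg 11 = e v ∧ u ∈ C ∧ v ∈ C ∧ D u v < n ∧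
          m2.rreg 0 = (f v - f u) / D u v) ∧
        ∀ u' v', (u', v') ∈ insert (u, v) S → u' ∈ C → v' ∈ C → D u' v' < n →
          (f v' - f u') / D u' v' ≤ m2.rreg 0 := by
      intro m2 ha' k10 k11 k0 hle
      rw [k10, k11, k0]
      refine ⟨(ha'.ireg 4 (by decide)).trans hu1, (ha'.ireg 5 (by decide)).trans hv1,
        hm1.agree ha', (hmD.agree ha).agree ha', hbest, ?_⟩
      rintro u' v' (h | h)
      · obtain ⟨rfl, rfl⟩ := Prod.ext_iff.1 h
        exact hle
      · exact hS u' v' h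
    refine ⟨fun hb => ⟨fun hb' => ?_, fun hb' => ?_⟩, fun hb => ?_⟩
    · simp only [Test.Holds, h7, h8, hm1.one, hm1.size] at hb hb'
      have huv : u ∈ C ∧ v ∈ C := by
        split_ifs at hb <;> first | omega | exact ⟨by assumption, by assumption⟩
      refine wp_seq (fun m2 => Agree m1 m2 ∧ m2.ireg 10 = m1.ireg 10 ∧ m2.ireg 11 = m1.ireg 11 ∧
        m2.rreg 0 = m1.rreg 0 ∧ m2.rreg 1 = D u v ∧ m2.rreg 2 = f v - f u ∧
        m2.rreg 3 = (f v - f u) / D u v)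
        ⟨⟨fun x hx => by interval_cases x <;> rfl, rfl, rfl⟩, rfl, rfl, rfl,
          by simp [Instr.exec, h8],
          by simp [Instr.exec, hm1.zero, hu1, hv1, hm1.tone _ huv.1, hm1.tone _ huv.2],
          by simp [Instr.exec, hm1.zero, hu1, hv1, hm1.tone _ huv.1, hm1.tone _ huv.2, h8]⟩ ?_
      rintro m2 ⟨ha', k10, k11, k0, k1, k2, k3⟩
      have hm2 := hm1.agree ha'
      have hu2 : m2.ireg 4 = e u := (ha'.ireg 4 (by decide)).trans hu1
      have hv2 : m2.ireg 5 = e v := (ha'.ireg 5 (by decide)).trans hv1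
      refine ⟨fun hlt => ?_, fun hlt => ?_⟩
      · simp only [Test.Holds, k0, k3] at hlt
        set m3 := ((m2.setIreg 10 (m2.ireg 4 + m2.ireg 2)).setIreg 11 (m2.ireg 5 + m2.ireg 2)) with hm3
        have ha3 : Agree m2 { m3 with rreg := Function.update m2.rreg 0 (m2.rreg 2 / m2.rreg 1) } :=
          (((Agree.refl m2).setIreg (by decide) _).setIreg (by decide) _).setRreg 0 _
        change _ ∧ _ ∧ Memory e G f i C
          { m3 with rreg := Function.update m2.rreg 0 (m2.rreg 2 / m2.rreg 1) } ∧ _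
        refine ⟨hu2, hv2, hm2.agree ha3, ((hmD.agree ha).agree ha').agree ha3,
          Or.inr ⟨u, v, ?_, ?_, huv.1, huv.2, hb', ?_⟩, ?_⟩
        · simp [Instr.exec, hu2, hm2.zero]
        · simp [Instr.exec, hv2, hm2.zero]
        · simp [Instr.exec, k1, k2]
        · have : ({ m3 with rreg := Function.update m2.rreg 0 (m2.rreg 2 / m2.rreg 1) } : Store).rreg 0
              = (f v - f u) / D u v := by simp [k1, k2]
          change ∀ u' v', (u', v') ∈ insert (u, v) S → u' ∈ C → v' ∈ C → D u' v' < n →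
            (f v' - f u') / D u' v' ≤ ({ m3 with
              rreg := Function.update m2.rreg 0 (m2.rreg 2 / m2.rreg 1) } : Store).rreg 0
          rw [this]
          rintro u' v' (h | h) h1 h2 h3
          · obtain ⟨rfl, rfl⟩ := Prod.ext_iff.1 h
            exact le_rfl
          · exact (hS u' v' h h1 h2 h3).trans hlt.le
      · simp only [Test.Holds, k0, k3] at hlt
        exact skip m2 ha' k10 k11 k0 fun _ _ _ => not_lt.1 hlt
    · simp only [Test.Holds, h8, hm1.size] at hb'
      exact skip m1 (.refl _) rfl rfl rfl fun _ _ h => absurd h hb'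
    · simp only [Test.Holds, h7, hm1.one] at hb
      refine skip m1 (.refl _) rfl rfl rfl fun h1 h2 => absurd ?_ hb
      simp [h1, h2]
  · rintro m ⟨hm, hmD, hbest, hS⟩
    refine ⟨hm, hmD, ?_⟩
    obtain ⟨c, hc⟩ := hC
    have hcc := hS c c trivial hc hc (hD c)
    rw [sub_self, zero_div] at hcc
    rcases hbest with h | ⟨u, v, h10, h11, hu, hv, hlt, heq⟩
    · rw [h] at hcc
      norm_num at hcc
    · exact ⟨u, v, h10, h11, hu, hv, hlt, heq, fun u' hu' v' hv' => hS u' v' trivial hu' hv'⟩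

theorem Memory.setColour (h : Memory e G f i C m) (w : V) :
    Memory e G f i (insert w C)
      { m with imat := setEntry m.imat 1 0 (e w) 1, rmat := setEntry m.rmat 1 0 (e w) (f w) } := by
  classical
  have h0 : setEntry m.imat 1 0 (e w) 1 0 = m.imat 0 := setEntry_of_ne _ (by decide) _ _ _
  refine ⟨h.size, h.one, h.zero, h.round, ?_, ?_, ?_, ?_, ?_⟩
  · simp only [h0]; exact h.adj
  · simp only [h0]; exact h.not_adj
  · intro v hv
    simp only [setEntry_vertex_zero]
    split_ifs with hc
    · rfl
    · exact h.coloured v (hv.resolve_left hc)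
  · intro v hv
    simp only [setEntry_vertex_zero]
    rw [Set.mem_insert_iff, not_or] at hv
    rw [if_neg hv.1, h.not_coloured v hv.2]
  · intro v hv
    simp only [setEntry_vertex_zero]
    split_ifs with hc
    · rw [hc]
    · exact h.tone v (hv.resolve_left hc)

/-- By `hf` every write stores a value of `f`, so coloured vertices on the geodesics, among them `u`
itself, may be written again. -/
theorem wp_colour (h : Memory e G f i C m) {D : V → V → ℕ} (hm : HoldsDist e D m) {u v : V}
    (h10 : m.ireg 10 = e u) (h11 : m.ireg 11 = e v) (hu : u ∈ C)
    (hf : ∀ w, D u w + D w v ≤ D u v → f u + D u w * m.rreg 0 = f w) :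
    wp n colour (fun m' => Memory e G f i (C ∪ {w | D u w + D w v ≤ D u v}) m' ∧
      HoldsDist e D m') m := by
  refine wp_seq (fun m' => Agree m m' ∧ m'.ireg 10 = e u ∧ m'.ireg 11 = e v ∧
    m'.rreg 0 = m.rreg 0 ∧ m'.rreg 1 = f u ∧ m'.ireg 9 = D u v)
    ⟨⟨fun x hx => by interval_cases x <;> rfl, rfl, rfl⟩, h10, h11, rfl,
      by simp [Instr.exec, h.zero, h10, h.tone _ hu],
      by simp [Instr.exec, h10, h11, hm u v]⟩ ?_
  rintro m1 ⟨ha, k10, k11, k0, k1, k9⟩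
  generalize m.rreg 0 = b at *
  refine wp_forVertex e (fun S m => Memory e G f i (C ∪ {w | w ∈ S ∧ D u w + D w v ≤ D u v}) m ∧
    HoldsDist e D m ∧ m.ireg 10 = e u ∧ m.ireg 11 = e v ∧ m.rreg 0 = b ∧ m.rreg 1 = f u ∧
    m.ireg 9 = D u v)
    (fun S m k h => ⟨h.1.setIreg (by decide) k, h.2⟩) (fun S m h => ⟨h.1.size, h.1.one⟩)
    ⟨by simpa using h.agree ha, hm.agree ha, k10, k11, k0, k1, k9⟩ ?_ ?_
  · rintro S w - m ⟨hm, hmD, h10, h11, h0, h1, h9⟩ hw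
    refine wp_seq (fun m' => Agree m m' ∧ m'.ireg 10 = e u ∧ m'.ireg 11 = e v ∧
      m'.rreg 0 = b ∧ m'.rreg 1 = f u ∧ m'.ireg 9 = D u v ∧ m'.ireg 7 = D u w ∧
      m'.ireg 8 = D u w + D w v)
      ⟨⟨fun x hx => by interval_cases x <;> rfl, rfl, rfl⟩, h10, h11, h0, h1, h9,
        by simp [Instr.exec, h10, hw, hmD u w],
        by simp [Instr.exec, h10, h11, hw, hmD u w, hmD w v]⟩ ?_
    rintro m1 ⟨ha, k10, k11, k0, k1, k9, k7, k8⟩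
    have hm1 := hm.agree ha
    have hw1 : m1.ireg 4 = e w := (ha.ireg 4 (by decide)).trans hw
    refine ⟨fun hb => ?_, fun hb => ?_⟩
    · simp only [Test.Holds, k8, k9] at hb
      refine ⟨hw1, ?_, hmD.agree ha, k10, k11, k0, k1, k9⟩
      convert hm1 using 1
      congr 1
      ext x
      simp only [Set.mem_ofPred_eq, Set.mem_insert_iff]
      refine ⟨fun h => ⟨h.1.resolve_left ?_, h.2⟩, fun h => ⟨Or.inr h.1, h.2⟩⟩
      rintro rfl
      omega
    · simp only [Test.Holds, k8, k9, not_lt] at hb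
      refine wp_seq (p := .instr _) (fun m' => Agree m1 m' ∧ m'.ireg = m1.ireg ∧ m'.rreg 0 = b ∧
        m'.rreg 1 = f u ∧ m'.rreg 2 = D u w)
        ⟨⟨fun x hx => rfl, rfl, rfl⟩, rfl, k0, k1, by simp [Instr.exec, k7]⟩ ?_
      rintro m2 ⟨ha2, j, j0, j1, j2⟩
      refine wp_seq (p := .instr _) (fun m' => Agree m1 m' ∧ m'.ireg = m1.ireg ∧ m'.rreg 0 = b ∧
        m'.rreg 1 = f u ∧ m'.rreg 2 = D u w * b)
        ⟨ha2.trans ⟨fun x hx => rfl, rfl, rfl⟩, j, j0, j1, by simp [Instr.exec, j0, j2]⟩ ?_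
      rintro m3 ⟨ha3, j, j0, j1, j2⟩
      refine wp_seq (p := .instr _) (fun m' => Agree m1 m' ∧ m'.ireg = m1.ireg ∧ m'.rreg 0 = b ∧
        m'.rreg 1 = f u ∧ m'.rreg 2 = f w)
        ⟨ha3.trans ⟨fun x hx => rfl, rfl, rfl⟩, j, j0, j1,
          by simp [Instr.exec, j1, j2, hf w hb]⟩ ?_
      rintro m4 ⟨ha4, j, j0, j1, j2⟩
      have hm4 := hm1.agree ha4
      have h' := hm4.setColour w
      have heq : ({ m4 with imat := setEntry m4.imat 1 0 (e w) 1,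
                            rmat := setEntry m4.rmat 1 0 (e w) (f w) } : Store) =
          (Instr.istore 1 2 4 1).exec ((Instr.rstore 1 2 4 2).exec m4) := by
        simp [Instr.exec, hm1.zero, hm1.one, j2, j, hw1]
      have hset : insert w (C ∪ {w | w ∈ S ∧ D u w + D w v ≤ D u v}) =
          C ∪ {x | x ∈ insert w S ∧ D u x + D x v ≤ D u v} := by
        ext x
        simp only [Set.mem_insert_iff, Set.mem_union, Set.mem_ofPred_eq]
        constructor
        · rintro (rfl | h | h)
          · exact Or.inr ⟨Or.inl rfl, hb⟩
          · exact Or.inl h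
          · exact Or.inr ⟨Or.inr h.1, h.2⟩
        · rintro (h | ⟨h | h, h'⟩)
          · exact Or.inr (Or.inl h)
          · exact Or.inl h
          · exact Or.inr (Or.inr ⟨h, h'⟩)
      rw [heq, hset] at h'
      refine ⟨?_, h', ?_, ?_, ?_, j0, j1, ?_⟩
      · change m4.ireg 4 = e w
        rw [j, hw1]
      · intro a b
        change setEntry m4.imat 1 (m4.ireg 2) (m4.ireg 4) (m4.ireg 1) 2 (e a) (e b) = D a b
        rw [setEntry_of_ne _ (by decide), ha4.imat]
        exact hmD.agree ha a b
      · change m4.ireg 10 = e u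
        rw [j, k10]
      · change m4.ireg 11 = e v
        rw [j, k11]
      · change m4.ireg 9 = D u v
        rw [j, k9]
  · rintro m ⟨hm, hmD, -⟩
    exact ⟨by simpa using hm, hmD⟩

/-- The row that is read is also overwritten, but only by values of `f`; the marks of `C` stay
fixed, so sources remain valid throughout. -/
theorem wp_spread (h : Memory e G f i C m) {D : V → V → ℕ} (hm : HoldsDist e D m)
    (hD : Determines n C f D) : wp n spread (IsOutput e f) m := by
  classical
  refine wp_forPair e (by decide) (fun S m => Memory e G f i C m ∧ HoldsDist e D m ∧
    ∀ u v, (u, v) ∈ S → v ∈ C → D u v < n → m.rmat 1 0 (e u) = f u)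
    (fun S m k h => ⟨h.1.setIreg (by decide) k, h.2⟩)
    (fun S m k h => ⟨h.1.setIreg (by decide) k, h.2⟩) (fun S m h => ⟨h.1.size, h.1.one⟩)
    ⟨h, hm, by simp⟩ ?_ ?_
  · rintro S u v - m ⟨hm, hmD, hS⟩ hu hv
    refine wp_seq (fun m' => Agree m m' ∧ m'.ireg 7 = (if v ∈ C then 1 else 0) ∧ m'.ireg 8 = D u v)
      ⟨⟨fun x hx => by interval_cases x <;> rfl, rfl, rfl⟩,
        by simp [Instr.exec, hm.zero, hv, hm.coloured_eq],
        by simp [Instr.exec, hu, hv, hmD u v]⟩ ?_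
    rintro m1 ⟨ha, h7, h8⟩
    have hm1 := hm.agree ha
    have hu1 : m1.ireg 4 = e u := (ha.ireg 4 (by decide)).trans hu
    have hv1 : m1.ireg 5 = e v := (ha.ireg 5 (by decide)).trans hv
    rw [← ha.rmat] at hS
    have skip : ¬ (v ∈ C ∧ D u v < n) → m1.ireg 4 = e u ∧ m1.ireg 5 = e v ∧ Memory e G f i C m1 ∧
        HoldsDist e D m1 ∧ ∀ u' v', (u', v') ∈ insert (u, v) S → v' ∈ C → D u' v' < n →
          m1.rmat 1 0 (e u') = f u' := by
      intro hn
      refine ⟨hu1, hv1, hm1, hmD.agree ha, ?_⟩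
      rintro u' v' (h | h) h1 h2
      · obtain ⟨rfl, rfl⟩ := Prod.ext_iff.1 h
        exact absurd ⟨h1, h2⟩ hn
      · exact hS u' v' h h1 h2
    refine ⟨fun hb => ⟨fun hb' => ?_, fun hb' => ?_⟩, fun hb => ?_⟩
    · simp only [Test.Holds, h7, h8, hm1.size, hm1.zero] at hb hb'
      have hvC : v ∈ C := by
        by_contra h
        simp [h] at hb
      refine wp_seq (p := .instr _) (fun m' => Agree m1 m' ∧ m'.rreg 1 = f u)
        ⟨⟨fun x hx => rfl, rfl, rfl⟩, ?_⟩ ?_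
      · simp [Instr.exec, hm1.zero, hv1, hm1.tone v hvC, (hD u).2 v hb']
      rintro m2 ⟨ha2, h1⟩
      have hm2 := hm1.agree ha2
      have hu2 : m2.ireg 4 = e u := (ha2.ireg 4 (by decide)).trans hu1
      have hv2 : m2.ireg 5 = e v := (ha2.ireg 5 (by decide)).trans hv1
      have hr : ∀ w, ((Instr.rstore 1 2 4 1).exec m2).rmat 1 0 (e w) =
          if w = u then f u else m1.rmat 1 0 (e w) := by
        intro w
        simp only [Instr.exec, hm2.zero, hu2, h1, setEntry_vertex_zero, ha2.rmat]
      refine ⟨hu2, hv2, ⟨hm2.size, hm2.one, hm2.zero, hm2.round, hm2.adj, hm2.not_adj, hm2.coloured,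
        hm2.not_coloured, fun w hw => ?_⟩, fun a b => (hmD.agree ha).agree ha2 a b, ?_⟩
      · rw [hr]
        split_ifs with hc
        · rw [hc]
        · exact hm1.tone w hw
      · rintro u' v' h h2 h3
        rw [hr]
        split_ifs with hc
        · rw [hc]
        · exact hS u' v' (h.resolve_left fun h => hc (Prod.ext_iff.1 h).1) h2 h3
    · simp only [Test.Holds, h8, hm1.size] at hb'
      exact skip fun h => hb' h.2
    · simp only [Test.Holds, h7, hm1.zero] at hb
      exact skip fun h => hb (by simp [h.1])
  · rintro m ⟨-, -, hS⟩ u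
    obtain ⟨c, hc, hlt⟩ := (hD u).1
    exact hS u c trivial hc hlt

/-- The whole row is copied, including arbitrary entries outside `C`, about which the invariant says
nothing; the round counter is arbitrary too. -/
theorem wp_prepare {g : C → ℝ} (hg : Compatible g f) (h : IsInput e G g m) :
    wp n prepare (fun m' => ∃ i, Memory e G f i C m') m := by
  classical
  obtain ⟨h0, hadj, hcol, htone⟩ := h
  refine wp_seq (fun m' => m'.ireg 0 = n ∧ m'.ireg 1 = 1 ∧ m'.ireg 2 = 0 ∧ m'.imat = m.imat ∧
    m'.rmat = m.rmat) ⟨h0, by simp [Instr.exec], by simp [Instr.exec], rfl, rfl⟩ ?_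
  rintro m1 ⟨k0, k1, k2, ki, kr⟩
  refine wp_forVertex e (fun S m' => m'.ireg 0 = n ∧ m'.ireg 1 = 1 ∧ m'.ireg 2 = 0 ∧
    m'.imat = m.imat ∧ m'.rmat 0 = m.rmat 0 ∧ ∀ v ∈ S, v ∈ C → m'.rmat 1 0 (e v) = f v)
    (fun S m k h => by simpa [Store.setIreg] using h) (fun S m h => ⟨h.1, h.2.1⟩)
    ⟨k0, k1, k2, ki, by rw [kr], by simp⟩ ?_ ?_
  · rintro S v - m' ⟨k0, k1, k2, ki, kr, kS⟩ hv
    refine ⟨hv, k0, k1, k2, ki, ?_, ?_⟩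
    · rw [← kr]
      funext a b
      simp [Instr.exec, setEntry]
    · intro w hw hwC
      simp only [Instr.exec, k2, hv, setEntry_vertex_zero, Function.update_self, kr]
      split_ifs with hc
      · rw [hc] at hwC ⊢
        exact (htone ⟨v, hwC⟩).trans (hg ⟨v, hwC⟩).symm
      · exact kS w (hw.resolve_left hc) hwC
  · rintro m' ⟨k0, k1, k2, ki, kr, kS⟩
    refine ⟨_, k0, k1, k2, rfl, ?_, ?_, ?_, ?_, fun v hv => kS v trivial hv⟩
    · intro u v huv; rw [ki, hadj]; simp [huv]
    · intro u v huv; rw [ki, hadj]; simp [huv]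
    · intro v hv; rw [ki, hcol]; simp [hv]
    · intro v hv; rw [ki, hcol]; simp [hv]

theorem wp_program [Fintype V] {e : V ≃ Fin (Fintype.card V)} {Vc : Set V} {g : Vc → ℝ}
    (hG : G.Connected) (hne : Vc.Nonempty) (hg : Compatible g f) (hf : IsBalanced G Vc f)
    (h : IsInput e G g m) : wp (Fintype.card V) program (IsOutput e f) m := by
  have hpos : 0 < Fintype.card V := Fintype.card_pos_iff.2 ⟨hne.some⟩
  refine wp_seq _ (wp_prepare hg h) ?_
  rintro m1 ⟨i, hm1⟩
  refine wp_seq (fun m => ∃ i C D, Memory e G f i C m ∧ HoldsDist e D m ∧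
    Determines (Fintype.card V) C f D) ?_
    (fun m ⟨i, C, D, h1, h2, h3⟩ => wp_spread h1 h2 h3)
  -- Before round `k` there are at least `k + 1` coloured vertices, unless flatness has been
  -- reached. Flatness survives further colouring, and each later round leaves a fresh matrix that
  -- determines `f`.
  refine wp_forLoop (fun k m => ∃ i C, Memory e G f i C m ∧ Vc ⊆ C ∧
    (k + 1 ≤ C.ncard ∨ IsFlat G C f ∧ ∃ D, HoldsDist e D m ∧ Determines (Fintype.card V) C f D))
    ?_ (fun k m ⟨i, C, h, _⟩ => ⟨h.size, h.one⟩)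
    ⟨i, Vc, hm1, subset_rfl, Or.inl ((Set.ncard_pos (Set.toFinite _)).2 hne)⟩ ?_ ?_
  · rintro k m x ⟨i, C, h, h'⟩
    exact ⟨x, C, ⟨h.size, h.one, h.zero, by simp [Store.setIreg], h.adj, h.not_adj, h.coloured,
      h.not_coloured, h.tone⟩, h'⟩
  · rintro k - m ⟨i, C, hm, hVC, hC⟩ hk
    obtain rfl : i = k := hm.round.symm.trans hk
    have hCne : C.Nonempty := hne.mono hVC
    refine wp_seq _ (wp_initDist hm) ?_
    rintro m2 ⟨hm2, hD2⟩
    refine wp_seq _ (wp_allDist hm2 (isPartialDist_adjDist (openGraph G C) hpos) hD2) ?_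
    rintro m3 ⟨hm3, D, hD, hD3⟩
    have hcap := hD.isCappedDist
    refine wp_seq _ (wp_steepest hm3 hD3 hCne fun u => (hcap.lt_iff u u).2 (.refl _)) ?_
    rintro m4 ⟨hm4, hD4, u, v, h10, h11, hst⟩
    have hbal := hf.openGraph hVC
    refine wp_mono ?_ (wp_colour hm4 hD4 h10 h11 hst.left fun w hw => hst.eq_of_mem hbal hcap hw)
    rintro m5 ⟨hm5, hD5⟩
    refine ⟨hm5.round, i, _, hm5, hVC.trans Set.subset_union_left, ?_⟩
    have flat : IsFlat G C f → IsFlat G (C ∪ {w | D u w + D w v ≤ D u v}) f ∧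
        ∃ D', HoldsDist e D' m5 ∧ Determines (Fintype.card V) (C ∪ {w | D u w + D w v ≤ D u v}) f D' :=
      fun h => ⟨h.mono Set.subset_union_left, D, hD5,
        h.determines hG hcap hCne Set.subset_union_left⟩
    rcases hC with hC | hC
    · rcases hst.isFlat_or_exists hbal hcap with h | ⟨w, hw, hle⟩
      · exact Or.inr (flat h)
      · left
        have : C.ncard < (C ∪ {w | D u w + D w v ≤ D u v}).ncard :=
          Set.ncard_lt_ncard ⟨Set.subset_union_left, fun h => hw (h (Or.inr hle))⟩ (Set.toFinite _)
        omega
    · exact Or.inr (flat hC.1)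
  · rintro m ⟨i, C, hm, -, hC⟩
    rcases hC with hC | ⟨-, D, h1, h2⟩
    -- After all rounds the first alternative would need more coloured vertices than exist.
    · have := Set.ncard_le_card C
      rw [Nat.card_eq_fintype_card] at this
      omega
    · exact ⟨i, C, D, hm, h1, h2⟩

end Program

end Gradation

/-! ### The main theorem -/

theorem mainTheorem1 :
    ∃ (P : Prog) (C : ℕ),
      ∀ (V : Type*) [Fintype V] (G : SimpleGraph V) (Vc : Set V) (g : Vc → ℝ),
        G.Connected → IsIncompleteGreyscale g → (∃ u, g u = 0) → (∃ u, g u = 1) →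
        ∃ f : V → ℝ,
          -- `f` is the one and only compatible greyscale with minimum gradation vector
          (IsMinGradation G g f ∧ ∀ h : V → ℝ, IsMinGradation G g h → h = f) ∧
          -- every execution of the procedure halts, and its output is `f`
          (∀ (l : List (Option ℝ)) (σ : State V), Exec VertexLeft G g l σ →
            l.length ≤ G.edgeSet.ncard ∧
            (VertexLeft σ → ∃ (o : Option ℝ) (σ' : State V), Step σ o σ') ∧
            (¬ VertexLeft σ → σ.tone = f)) ∧
          -- `f` is computed in `O(n ^ 4)` steps
          (∀ (e : V ≃ Fin (Fintype.card V)) (m : Store), IsInput e G g m →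
            ∃ (t : ℕ) (m' : Store), Runs P m t m' ∧ t ≤ C * Fintype.card V ^ 4 ∧
              IsOutput e f m') ∧
          -- the same procedure, carried on until no edge is left, also halts with output `f`, and
          -- the maxima `M` that it finds are the distinct components of the gradation vector
          (∀ (l : List (Option ℝ)) (σ : State V), Exec EdgeLeft G g l σ →
            l.length ≤ G.edgeSet.ncard + 1 ∧
            (EdgeLeft σ → ∃ (o : Option ℝ) (σ' : State V), Step σ o σ') ∧
            (¬ EdgeLeft σ → σ.tone = f ∧
              ∃ (r : ℕ) (M : Fin r → ℝ) (k : Fin r → ℕ) (z z' : ℕ),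
                StrictAnti M ∧ (∀ i, 0 < M i ∧ 0 < k i) ∧
                l.reduceOption = List.ofFn M ++ List.replicate z' 0 ∧
                gradation G f =
                  (List.ofFn fun i => List.replicate (k i) (M i)).flatten ++
                    List.replicate z 0)) := by
  refine ⟨program, 1000, fun V _ G Vc g hG hg h0 h1 => ?_⟩
  obtain ⟨u₀, hu₀⟩ := h0
  obtain ⟨u₁, hu₁⟩ := h1
  have hne : Vc.Nonempty := ⟨u₀, u₀.2⟩
  obtain ⟨f, hf01, hfg, hf⟩ := exists_balanced G g hg
  have hgrey : IsGreyscale f := ⟨hf01, ⟨u₀, (hfg u₀).trans hu₀⟩, ⟨u₁, (hfg u₁).trans hu₁⟩⟩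
  have hlt : ∀ h : V → ℝ, Compatible g h → h ≠ f → gradation G f < gradation G h := fun h hh hne' =>
    hf.gradation_lt hG hne (fun v hv => (hh ⟨v, hv⟩).trans (hfg ⟨v, hv⟩).symm) hne'
  refine ⟨f, ⟨⟨hgrey, hfg, fun h _ hh => ?_⟩, fun h hh => ?_⟩, fun l σ hex => ?_, fun e m hm => ?_,
    fun l σ hex => ?_⟩
  · by_cases heq : h = f
    · rw [heq]
    · exact (hlt h hh heq).le
  · by_contra heq
    exact absurd (hlt h hh.2.1 heq) (not_lt.2 (hh.2.2 f hgrey hfg))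
  · have hs := hex.sound hG hne hfg hf
    refine ⟨hex.length_le_of_vertexLeft, fun _ => hs.exists_step, fun hv => ?_⟩
    funext v
    exact hs.tone_eq v ((not_not.1 hv).symm ▸ Set.mem_univ v)
  · obtain ⟨t, m', hr, ht, hout⟩ := exists_runs_of_wp (wp_program hG hne hfg hf hm)
    exact ⟨t, m', hr, ht.trans (cost_program_le (Fintype.card_pos_iff.2 ⟨u₀⟩)), hout⟩
  · have hs := hex.sound hG hne hfg hf
    refine ⟨hex.length_le_of_edgeLeft, fun _ => hs.exists_step, fun hv => ?_⟩
    have hbot : σ.graph = ⊥ := not_not.1 hv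
    obtain ⟨Ms, z, hrec⟩ := hex.exists_records hG hne hfg hf
    exact ⟨hs.tone_eq_of_edgeless hbot, hrec.exists_gradation_eq hbot⟩
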